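/- Let $G$ be a discrete group and let $\mathcal{C}$ be a collection of subgroups of $G$, i.e. a set of subgroups closed under $G$-conjugation, ordered by inclusion. Let $P\le G$ be a subgroup that is not conjugate in $G$ to a proper subgroup of itself (this holds automatically if $P$ is finite, in particular if $G$ is finite), and let $\mathcal{C}'$ be the subcollection obtained from $\mathcal{C}$ by removing all $G$-conjugates of $P$. Notation. The group $G$ acts on the poset $\mathcal{C}$ by conjugation. $E\mathbf{O}_{\mathcal{C}}$ is the category with objects the pairs $(G/H,x)$ with $H\in\mathcal{C}$ and $x\in G/H$, whose morphisms $(G/H,x)\to(G/H',x')$ are the $G$-maps $G/H\to G/H'$ sending $x$ to $x'$; $G$ acts by $g\cdot(G/H,x)=(G/H,gx)$. $E\mathbf{A}_{\mathcal{C}}$ is the category with objects the monomorphisms $i\colon H\to G$ with $H\in\mathcal{C}$ and $i(H)\in\mathcal{C}$, whose morphisms from $i\colon H\to G$ to $i'\colon H'\to G$ are the homomorphisms $\varphi\colon H\to H'$ with $i=i'\circ\varphi$; $G$ acts by $g\cdot i=c_g\circ i$, where $c_g(x)=gxg^{-1}$. For a small category (in particular a poset) $\mathcal{X}$, $|\mathcal{X}|$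 is the geometric realization of its nerve, and a poset is called contractible if its realization is a contractible space. Put $\mathbf{link}_{\mathcal{C}}(P)=\{Q\in\mathcal{C}\mid Q<P\text{ or }P<Q\}$. For a subgroup $H$, the subscripts $\ge H$ and $\le H$ denote the subposets of members containing $H$, resp. contained in $H$, and $\mathbf{link}_{\mathcal{C}}(P)^H$ is the subposet of the members that are normalized by $H$. A $G$-homotopy equivalence is a $G$-map with an inverse up to $G$-equivariant homotopy. 1. If $\mathbf{link}_{\mathcal{C}}(P)_{\ge H}$ is contractible for all $H\le P$, then the inclusion $|E\mathbf{O}_{\mathcal{C}'}|\to|E\mathbf{O}_{\mathcal{C}}|$ is a $G$-homotopy equivalence. 2. If $\mathbf{link}_{\mathcal{C}}(P)_{\le C_G(H)}$ is contractible for all $H\le C_G(P)$, then the inclusion $|E\mathbf{A}_{\mathcal{C}'}|\to|E\mathbf{A}_{\mathcal{C}}|$ is a $G$-homotopy equivalence. 3. If $\mathbf{link}_{\mathcal{C}}(P)^H$ is contractible for all $H\le N_G(P)$, then the inclusion $|\mathcal{C}'|\to|\mathcal{C}|$ is a $G$-homotopy equivalence. -/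

import Mathlib

open CategoryTheory

universe u

/-! ### `G`-categories, `G`-spaces, realizations of nerves -/

/-- The geometric realization `|A|` of the nerve of a small category, as a functor to spaces. -/
noncomputable def realization : Cat.{u, u} ⥤ TopCat.{u} := nerveFunctor ⋙ SSet.toTop

/-- The geometric realization of the nerve of a category with `G`-action, as a space with
`G`-action (where `G` is discrete). -/
noncomputable def gRealization (G : Type u) [Group G] :
    Action Cat.{u, u} G ⥤ Action TopCat.{u} G :=
  realization.mapAction G

/-- Two `G`-maps are `G`-homotopic if there is a homotopy `[0,1] × X → Y` between them which is
`G`-equivariant (with `G` acting trivially on `[0,1]`). -/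
def GHomotopic {G : Type u} [Group G] {X Y : Action TopCat.{u} G} (f₀ f₁ : X ⟶ Y) : Prop :=
  ∃ F : ContinuousMap.Homotopy f₀.hom.hom f₁.hom.hom,
    ∀ (g : G) (t : unitInterval) (x : X.V),
      F (t, (End.asHom (X.ρ g)).hom x) = (End.asHom (Y.ρ g)).hom (F (t, x))

/-- A `G`-map is a `G`-homotopy equivalence if it has an inverse up to `G`-homotopy. -/
def IsGHomotopyEquiv {G : Type u} [Group G] {X Y : Action TopCat.{u} G} (f : X ⟶ Y) : Prop :=
  ∃ k : Y ⟶ X, GHomotopic (f ≫ k) (𝟙 X) ∧ GHomotopic (k ≫ f) (𝟙 Y)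

/-- A poset is contractible if the geometric realization of its nerve is contractible. -/
def PosetContractible (X : Type u) [PartialOrder X] : Prop :=
  ContractibleSpace (realization.obj (Cat.of X))

/-- A `G`-action on a category with at most one morphism between any two objects. The
equations are only needed on objects, because parallel morphisms agree. -/
def thinAction {G : Type u} [Group G] (A : Type u) [Category.{u} A] [Quiver.IsThin A]
    (F : G → (A ⥤ A)) (h_one : ∀ a, (F 1).obj a = a)
    (h_mul : ∀ g h a, (F (g * h)).obj a = (F g).obj ((F h).obj a)) : Action Cat.{u, u} G where
  V := Cat.of A
  ρ :=
    { toFun := fun g => (F g).toCatHom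
      map_one' := by
        apply Cat.Hom.ext
        exact CategoryTheory.Functor.ext h_one
          (fun _ _ _ => Subsingleton.elim (α := (_ ⟶ (_ : A))) _ _)
      map_mul' := fun g h => by
        apply Cat.Hom.ext
        exact CategoryTheory.Functor.ext (h_mul g h)
          (fun _ _ _ => Subsingleton.elim (α := (_ ⟶ (_ : A))) _ _) }

/-- A functor commuting with the actions (on objects) as a map of `G`-categories. -/
def thinActionHom {G : Type u} [Group G] {A B : Type u} [Category.{u} A] [Quiver.IsThin A]
    [Category.{u} B] [Quiver.IsThin B]
    {F : G → (A ⥤ A)} {h_one : ∀ a, (F 1).obj a = a}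
    {h_mul : ∀ g h a, (F (g * h)).obj a = (F g).obj ((F h).obj a)}
    {F' : G → (B ⥤ B)} {h_one' : ∀ a, (F' 1).obj a = a}
    {h_mul' : ∀ g h a, (F' (g * h)).obj a = (F' g).obj ((F' h).obj a)}
    (J : A ⥤ B) (hJ : ∀ g a, J.obj ((F g).obj a) = (F' g).obj (J.obj a)) :
    thinAction A F h_one h_mul ⟶ thinAction B F' h_one' h_mul' where
  hom := J.toCatHom
  comm g := by
    apply Cat.Hom.ext
    exact CategoryTheory.Functor.ext (hJ g)
      (fun _ _ _ => Subsingleton.elim (α := (_ ⟶ (_ : B))) _ _)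

/-! ### Collections of subgroups -/

/-- The conjugate `g H g⁻¹`. -/
def conjSubgroup {G : Type u} [Group G] (g : G) (H : Subgroup G) : Subgroup G :=
  H.map (MulAut.conj g).toMonoidHom

theorem conjSubgroup_one {G : Type u} [Group G] (H : Subgroup G) : conjSubgroup 1 H = H := by
  ext x; simp [conjSubgroup, Subgroup.mem_map]

theorem conjSubgroup_mul {G : Type u} [Group G] (g h : G) (H : Subgroup G) :
    conjSubgroup (g * h) H = conjSubgroup g (conjSubgroup h H) := by
  ext x; simp [conjSubgroup, Subgroup.mem_map, mul_assoc]

theorem conjSubgroup_mono {G : Type u} [Group G] (g : G) {H K : Subgroup G} (h : H ≤ K) :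
    conjSubgroup g H ≤ conjSubgroup g K :=
  Subgroup.map_mono h

/-- A collection of subgroups: a set of subgroups closed under conjugation. -/
structure SubgroupCollection (G : Type u) [Group G] where
  carrier : Set (Subgroup G)
  conj_mem : ∀ (g : G) (H : Subgroup G), H ∈ carrier → conjSubgroup g H ∈ carrier

namespace SubgroupCollection

variable {G : Type u} [Group G]

/-- The subcollection obtained by removing all the conjugates of `P`. -/
def remove (C : SubgroupCollection G) (P : Subgroup G) : SubgroupCollection G where
  carrier := {Q | Q ∈ C.carrier ∧ ∀ g : G, Q ≠ conjSubgroup g P}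
  conj_mem g H hH := by
    refine ⟨C.conj_mem g H hH.1, fun k hk => hH.2 (g⁻¹ * k) ?_⟩
    rw [conjSubgroup_mul, ← hk, ← conjSubgroup_mul, inv_mul_cancel, conjSubgroup_one]

theorem remove_subset (C : SubgroupCollection G) (P : Subgroup G) :
    (C.remove P).carrier ⊆ C.carrier :=
  fun _ h => h.1

/-- The link of `P` in the poset `C`. -/
def link (C : SubgroupCollection G) (P : Subgroup G) : Set (Subgroup G) :=
  {Q | Q ∈ C.carrier ∧ (P < Q ∨ Q < P)}

/-- The members of the link of `P` that contain `H`. -/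
def linkGE (C : SubgroupCollection G) (P H : Subgroup G) : Set (Subgroup G) :=
  {Q | Q ∈ C.link P ∧ H ≤ Q}

/-- The members of the link of `P` that are contained in `K`. -/
def linkLE (C : SubgroupCollection G) (P K : Subgroup G) : Set (Subgroup G) :=
  {Q | Q ∈ C.link P ∧ Q ≤ K}

/-- The members of the link of `P` that are fixed by conjugation by every element of `H`,
i.e. that are normalized by `H`. -/
def linkFixed (C : SubgroupCollection G) (P H : Subgroup G) : Set (Subgroup G) :=
  {Q | Q ∈ C.link P ∧ ∀ h ∈ H, conjSubgroup h Q = Q}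

/-! #### The `G`-poset `C` -/

/-- Conjugation by `g` as a functor of the poset `C`. -/
def conjFunctor (C : SubgroupCollection G) (g : G) : C.carrier ⥤ C.carrier :=
  Monotone.functor
    (f := fun H : C.carrier => (⟨conjSubgroup g H.1, C.conj_mem g H.1 H.2⟩ : C.carrier))
    (fun _ _ h => conjSubgroup_mono g h)

/-- The poset `C`, ordered by inclusion, with `G` acting by conjugation. -/
def poset (C : SubgroupCollection G) : Action Cat.{u, u} G :=
  thinAction C.carrier C.conjFunctor (fun H => Subtype.ext (conjSubgroup_one H.1))
    (fun g h H => Subtype.ext (conjSubgroup_mul g h H.1))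

/-- The inclusion of posets `C' → C` for a subcollection `C' ⊆ C`. -/
def posetIncl {C' C : SubgroupCollection G} (hC : C'.carrier ⊆ C.carrier) :
    C'.poset ⟶ C.poset :=
  thinActionHom
    (Monotone.functor (f := Set.inclusion hC) (fun _ _ h => h))
    (fun _ _ => rfl)

/-! #### The `G`-category `EO_C` -/

/-- The objects of `EO_C`: pairs `(G/H, x)` with `H ∈ C` and `x ∈ G/H`. -/
structure EO (C : SubgroupCollection G) where
  H : Subgroup G
  mem : H ∈ C.carrier
  pt : G ⧸ H

/-- A morphism `(G/H, x) ⟶ (G/H', x')` is a `G`-map `G/H → G/H'` with `x ↦ x'`. -/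
@[ext]
structure EO.Hom {C : SubgroupCollection G} (X Y : EO C) where
  toMap : (G ⧸ X.H) →[G] (G ⧸ Y.H)
  map_pt : toMap X.pt = Y.pt

instance (C : SubgroupCollection G) : Category.{u} (EO C) where
  Hom X Y := EO.Hom X Y
  id X := ⟨MulActionHom.id G, rfl⟩
  comp f g := ⟨g.toMap.comp f.toMap, by
    rw [MulActionHom.comp_apply, f.map_pt, g.map_pt]⟩

instance (C : SubgroupCollection G) : Quiver.IsThin (EO C) := fun X Y => by
  refine ⟨fun f f' => EO.Hom.ext (MulActionHom.ext fun y => ?_)⟩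
  obtain ⟨g, rfl⟩ := MulAction.exists_smul_eq G X.pt y
  rw [map_smul, map_smul, f.map_pt, f'.map_pt]

/-- The action of `g` on `EO_C`: `(G/H, x) ↦ (G/H, gx)`, and `f ↦ f` on `G`-maps. -/
def EO.smulFunctor (C : SubgroupCollection G) (g : G) : EO C ⥤ EO C where
  obj X := ⟨X.H, X.mem, g • X.pt⟩
  map f := ⟨f.toMap, by
    rw [map_smul, f.map_pt]⟩

/-- The category `EO_C` with its `G`-action. -/
def EOAction (C : SubgroupCollection G) : Action Cat.{u, u} G :=
  thinAction (EO C) (EO.smulFunctor C)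
    (fun X => by simp [EO.smulFunctor])
    (fun g h X => by simp [EO.smulFunctor, mul_smul])

/-- The inclusion `EO_{C'} → EO_C` for a subcollection `C' ⊆ C`. -/
def EOIncl {C' C : SubgroupCollection G} (hC : C'.carrier ⊆ C.carrier) :
    C'.EOAction ⟶ C.EOAction :=
  thinActionHom
    { obj := fun X => (⟨X.H, hC X.mem, X.pt⟩ : EO C)
      map := fun f => ⟨f.toMap, f.map_pt⟩ }
    (fun _ _ => rfl)

/-! #### The `G`-category `EA_C` -/

/-- The objects of `EA_C`: monomorphisms `i : H → G` with `H ∈ C` and `i(H) ∈ C`. -/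
structure EA (C : SubgroupCollection G) where
  H : Subgroup G
  mem : H ∈ C.carrier
  i : H →* G
  inj : Function.Injective i
  range_mem : i.range ∈ C.carrier

theorem EA.eq_of_i_eq {C : SubgroupCollection G} {X Y : EA C} (hH : X.H = Y.H)
    (hi : ∀ x : X.H, X.i x = Y.i ⟨x.1, hH ▸ x.2⟩) : X = Y := by
  obtain ⟨H, _, i, _, _⟩ := X
  obtain ⟨H', _, i', _, _⟩ := Y
  obtain rfl : H = H' := hH
  obtain rfl : i = i' := MonoidHom.ext hi
  rfl

/-- A morphism from `i : H → G` to `i' : H' → G` is a homomorphism `φ : H → H'` such that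
`i` is the composite of `φ` and `i'`. -/
@[ext]
structure EA.Hom {C : SubgroupCollection G} (X Y : EA C) where
  φ : X.H →* Y.H
  comp_eq : Y.i.comp φ = X.i

instance (C : SubgroupCollection G) : Category.{u} (EA C) where
  Hom X Y := EA.Hom X Y
  id X := ⟨MonoidHom.id _, rfl⟩
  comp f g := ⟨g.φ.comp f.φ, by rw [← MonoidHom.comp_assoc, g.comp_eq, f.comp_eq]⟩

instance (C : SubgroupCollection G) : Quiver.IsThin (EA C) := fun X Y => by
  refine ⟨fun f f' => EA.Hom.ext (MonoidHom.ext fun y => Y.inj ?_)⟩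
  exact DFunLike.congr_fun (f.comp_eq.trans f'.comp_eq.symm) y

/-- The action of `g` on `EA_C`: `i ↦ c_g ∘ i` where `c_g(x) = g x g⁻¹`, and `φ ↦ φ`. -/
def EA.smulFunctor (C : SubgroupCollection G) (g : G) : EA C ⥤ EA C where
  obj X :=
    { H := X.H
      mem := X.mem
      i := (MulAut.conj g).toMonoidHom.comp X.i
      inj := (MulAut.conj g).injective.comp X.inj
      range_mem := by
        rw [MonoidHom.range_comp]
        exact C.conj_mem g _ X.range_mem }
  map f := ⟨f.φ, by rw [MonoidHom.comp_assoc, f.comp_eq]⟩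

/-- The category `EA_C` with its `G`-action. -/
def EAAction (C : SubgroupCollection G) : Action Cat.{u, u} G :=
  thinAction (EA C) (EA.smulFunctor C)
    (fun X => EA.eq_of_i_eq rfl (fun x => by
      change 1 * X.i x * 1⁻¹ = X.i x
      simp))
    (fun g h X => EA.eq_of_i_eq rfl (fun x => by
      change g * h * X.i x * (g * h)⁻¹ = g * (h * X.i x * h⁻¹) * g⁻¹
      simp [mul_assoc]))

/-- The inclusion `EA_{C'} → EA_C` for a subcollection `C' ⊆ C`. -/
def EAIncl {C' C : SubgroupCollection G} (hC : C'.carrier ⊆ C.carrier) :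
    C'.EAAction ⟶ C.EAAction :=
  thinActionHom
    { obj := fun X => (⟨X.H, hC X.mem, X.i, X.inj, hC X.range_mem⟩ : EA C)
      map := fun f => ⟨f.φ, f.comp_eq⟩ }
    (fun _ _ => rfl)

end SubgroupCollection

open Simplicial Opposite

/-! ### Maps out of a geometric realization -/


/-! The three statements are one. Each of the three `G`-categories is thin and equivalent to the
underlying poset, with a `G`-compatible label `Q` on every object: the isotropy group of the point,
the image of the monomorphism, or the subgroup itself. The isotropy group of an object labelled `Q`
is `S Q`, namely `Q`, `C_G(Q)` or `N_G(Q)`. In these terms each hypothesis says that the members `Q`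
of the link of `P` with `H ≤ S Q` form a contractible poset for every `H ≤ S P`. This common form is
`IsCollectionModel.isGHomotopyEquiv`.

Its proof is an equivariant acyclic carrier argument. Call an object of the large category `E` bad
if its label is conjugate to `P`. As `P` is not conjugate to a proper subgroup of itself, all bad
vertices of a chain are isomorphic. Assign to a chain with a bad vertex `p` the full subcategory of
the small category `E'` on the objects comparable to `p` and fixed by the stabilizer of the chain;
assign to any other chain the objects isomorphic to one of its vertices. These subcategories are
contractible (by the hypothesis in the first case, by a cone in the second), grow with the chain,
and are fixed by its stabilizer. Hence there is an equivariant map `r : |E| → |E'|` carried by them.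
Both `r ∘ J` and the identity of `|E'|` are carried by the restricted carrier. Both `J ∘ r` and the
identity of `|E|` are carried by the analogous carrier with values in `E`, where `p` itself is a
cone point. Maps with a common carrier are `G`-homotopic, so `r` is a `G`-homotopy inverse of `J`.

The carrier theorem (`IsCarrier.exists_isCarried`, `IsCarrier.exists_homotopy`) rests on
`exists_equivariant_map`, a Zorn argument extending a simplicial map over one orbit of nondegenerate
simplices at a time. Its values are singular simplices of `|E'|` or, for homotopies, of a path
space, so that products of realizations never enter. The filling step is radial extension of a map
from the boundary of a polytope into a contractible space (`exists_extension_of_polytope`).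
Injectivity of realization (`toTop_map_injective`) makes the boundary data consistent. -/

theorem sset_hom_map {X Y : SSet.{u}} (k : X ⟶ Y) {m n : SimplexCategory} (f : m ⟶ n)
    (x : X.obj (op n)) : k.app (op m) (X.map f.op x) = Y.map f.op (k.app (op n) x) :=
  NatTrans.naturality_apply k f.op x

theorem sset_comp_app {X Y Z : SSet.{u}} (k : X ⟶ Y) (l : Y ⟶ Z) {n : SimplexCategory}
    (x : X.obj (op n)) : (k ≫ l).app (op n) x = l.app (op n) (k.app (op n) x) := rfl

theorem sset_map_comp (X : SSet.{u}) {k m n : SimplexCategory} (g : k ⟶ m) (f : m ⟶ n)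
    (x : X.obj (op n)) : X.map (g ≫ f).op x = X.map g.op (X.map f.op x) := by
  rw [op_comp, X.map_comp]
  rfl

theorem sset_map_id (X : SSet.{u}) {n : SimplexCategory} (x : X.obj (op n)) :
    X.map (𝟙 n).op x = x := by
  rw [op_id, X.map_id]
  rfl

/-- The topological standard simplex. -/
abbrev TopSimplex (n : SimplexCategory) : Type := stdSimplex ℝ (Fin (n.len + 1))

/-- The affine map of topological simplices induced by a simplicial operator. -/
noncomputable def topSimplexMap {m n : SimplexCategory} (f : m ⟶ n) :
    C(TopSimplex m, TopSimplex n) :=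
  ⟨stdSimplex.map f, stdSimplex.continuous_map f⟩

theorem topSimplexMap_apply {m n : SimplexCategory} (f : m ⟶ n) (t : TopSimplex m)
    (i : Fin (n.len + 1)) : topSimplexMap f t i = ∑ j with f j = i, t j :=
  FunOnFinite.linearMap_apply_apply ℝ ℝ f t i

theorem topSimplexMap_comp {k m n : SimplexCategory} (g : k ⟶ m) (f : m ⟶ n) (t : TopSimplex k) :
    topSimplexMap (g ≫ f) t = topSimplexMap f (topSimplexMap g t) :=
  (stdSimplex.map_comp_apply (S := ℝ) g f t).symm

/-- A map from a simplicial set to a singular simplicial set, given by a compatible family of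
continuous maps on topological simplices. -/
noncomputable def toSSetMk {X : SSet.{u}} {Y : TopCat.{u}}
    (φ : ∀ n : SimplexCategory, X.obj (op n) → C(TopSimplex n, Y))
    (hφ : ∀ {m n : SimplexCategory} (f : m ⟶ n) (x : X.obj (op n)) (t : TopSimplex m),
      φ m (X.map f.op x) t = φ n x (topSimplexMap f t)) : X ⟶ TopCat.toSSet.obj Y where
  app n := ↾fun x => (TopCat.toSSetObjEquiv Y n).symm (φ n.unop x)
  naturality := by
    intro n m f
    ext x
    apply (TopCat.toSSetObjEquiv Y m).injective
    ext t
    exact hφ f.unop x t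

/-- The continuous map underlying a singular simplex. -/
noncomputable def singMap {Y : TopCat.{u}} {n : SimplexCategory}
    (y : (TopCat.toSSet.obj Y).obj (op n)) : C(TopSimplex n, Y) :=
  TopCat.toSSetObjEquiv Y (op n) y

theorem singMap_injective {Y : TopCat.{u}} {n : SimplexCategory} :
    Function.Injective (singMap (Y := Y) (n := n)) :=
  (TopCat.toSSetObjEquiv Y (op n)).injective

theorem singMap_surjective {Y : TopCat.{u}} {n : SimplexCategory} :
    Function.Surjective (singMap (Y := Y) (n := n)) :=
  (TopCat.toSSetObjEquiv Y (op n)).surjective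

theorem singMap_map {Y : TopCat.{u}} {m n : SimplexCategory} (f : m ⟶ n)
    (y : (TopCat.toSSet.obj Y).obj (op n)) (t : TopSimplex m) :
    singMap ((TopCat.toSSet.obj Y).map f.op y) t = singMap y (topSimplexMap f t) := rfl

theorem singMap_toSSet_map {Y Z : TopCat.{u}} (k : Y ⟶ Z) {n : SimplexCategory}
    (y : (TopCat.toSSet.obj Y).obj (op n)) (t : TopSimplex n) :
    singMap ((TopCat.toSSet.map k).app (op n) y) t = k (singMap y t) := rfl

theorem singMap_toSSetMk {X : SSet.{u}} {Y : TopCat.{u}}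
    (φ : ∀ n : SimplexCategory, X.obj (op n) → C(TopSimplex n, Y)) (hφ)
    {n : SimplexCategory} (x : X.obj (op n)) :
    singMap ((toSSetMk φ hφ).app (op n) x) = φ n x :=
  (TopCat.toSSetObjEquiv Y (op n)).apply_symm_apply _

/-- The unit of the adjunction between realization and singular simplices. -/
noncomputable def realUnit (X : SSet.{u}) : X ⟶ TopCat.toSSet.obj (SSet.toTop.obj X) :=
  sSetTopAdj.unit.app X

theorem realUnit_naturality {X X' : SSet.{u}} (k : X ⟶ X') :
    k ≫ realUnit X' = realUnit X ≫ TopCat.toSSet.map (SSet.toTop.map k) :=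
  sSetTopAdj.unit.naturality k

/-- The characteristic map of a simplex of `X`. -/
noncomputable def charMap {X : SSet.{u}} {n : SimplexCategory} (x : X.obj (op n)) :
    C(TopSimplex n, SSet.toTop.obj X) :=
  singMap ((realUnit X).app (op n) x)

theorem charMap_map {X : SSet.{u}} {m n : SimplexCategory} (f : m ⟶ n) (x : X.obj (op n))
    (t : TopSimplex m) : charMap (X.map f.op x) t = charMap x (topSimplexMap f t) := by
  unfold charMap
  rw [sset_hom_map (realUnit X) f x, singMap_map]

theorem toTop_map_charMap {X X' : SSet.{u}} (k : X ⟶ X') {n : SimplexCategory}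
    (x : X.obj (op n)) (t : TopSimplex n) :
    SSet.toTop.map k (charMap x t) = charMap (k.app (op n) x) t := by
  unfold charMap
  rw [← singMap_toSSet_map, ← sset_comp_app, ← sset_comp_app, realUnit_naturality]

/-- The map out of the realization adjoint to a map to a singular simplicial set. -/
noncomputable def realDesc {X : SSet.{u}} {Y : TopCat.{u}} (φ : X ⟶ TopCat.toSSet.obj Y) :
    SSet.toTop.obj X ⟶ Y :=
  (sSetTopAdj.homEquiv X Y).symm φ

theorem homEquiv_eq_realUnit_comp {X : SSet.{u}} {Y : TopCat.{u}} (k : SSet.toTop.obj X ⟶ Y) :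
    sSetTopAdj.homEquiv X Y k = realUnit X ≫ TopCat.toSSet.map k :=
  sSetTopAdj.homEquiv_unit X Y k

theorem realUnit_realDesc {X : SSet.{u}} {Y : TopCat.{u}} (φ : X ⟶ TopCat.toSSet.obj Y) :
    realUnit X ≫ TopCat.toSSet.map (realDesc φ) = φ := by
  rw [← homEquiv_eq_realUnit_comp]
  exact (sSetTopAdj.homEquiv X Y).apply_symm_apply φ

theorem realDesc_charMap {X : SSet.{u}} {Y : TopCat.{u}} (φ : X ⟶ TopCat.toSSet.obj Y)
    {n : SimplexCategory} (x : X.obj (op n)) (t : TopSimplex n) :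
    realDesc φ (charMap x t) = singMap (φ.app (op n) x) t := by
  conv_rhs => rw [← realUnit_realDesc φ]
  exact (singMap_toSSet_map (realDesc φ) ((realUnit X).app (op n) x) t).symm

/-- By adjunction a map out of a realization is the same as its family of singular simplices, so
equalities of such maps can be tested on characteristic maps. -/
theorem real_hom_ext {X : SSet.{u}} {Y : TopCat.{u}} {k k' : SSet.toTop.obj X ⟶ Y}
    (h : ∀ (n : SimplexCategory) (x : X.obj (op n)) (t : TopSimplex n),
      k (charMap x t) = k' (charMap x t)) : k = k' := by
  apply (sSetTopAdj.homEquiv X Y).injective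
  rw [homEquiv_eq_realUnit_comp, homEquiv_eq_realUnit_comp]
  ext n x
  apply singMap_injective (n := n.unop)
  ext t
  exact h n.unop x t

/-! ### Realization preserves injectivity -/

theorem topSimplexMap_apply_of_injective {m n : SimplexCategory} (s : m ⟶ n)
    (hs : Function.Injective s.toOrderHom) (u : TopSimplex m) (i : Fin (m.len + 1)) :
    topSimplexMap s u (s.toOrderHom i) = u i := by
  rw [topSimplexMap_apply, Finset.sum_eq_single i]
  · intro j hj hji
    exact absurd (hs (Finset.mem_filter.1 hj).2) hji
  · intro h
    exact (h (by rw [Finset.mem_filter]; exact ⟨Finset.mem_univ _, rfl⟩)).elim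

theorem topSimplexMap_apply_pos {m n : SimplexCategory} (s : m ⟶ n) (u : TopSimplex m)
    (i : Fin (m.len + 1)) (hi : 0 < u i) : 0 < topSimplexMap s u (s.toOrderHom i) := by
  rw [topSimplexMap_apply]
  exact Finset.sum_pos' (fun j _ => stdSimplex.zero_le u j)
    ⟨i, Finset.mem_filter.2 ⟨Finset.mem_univ _, rfl⟩, hi⟩

theorem exists_of_topSimplexMap_apply_ne_zero {m n : SimplexCategory} (s : m ⟶ n)
    (u : TopSimplex m) {i : Fin (n.len + 1)} (hi : topSimplexMap s u i ≠ 0) :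
    ∃ j, s.toOrderHom j = i := by
  rw [topSimplexMap_apply] at hi
  obtain ⟨j, hj, -⟩ := Finset.exists_ne_zero_of_sum_ne_zero hi
  exact ⟨j, (Finset.mem_filter.1 hj).2⟩

theorem topSimplexMap_injective {m n : SimplexCategory} (s : m ⟶ n)
    (hs : Function.Injective s.toOrderHom) : Function.Injective (topSimplexMap s) := by
  intro u v h
  ext i
  rw [← topSimplexMap_apply_of_injective s hs u, h, topSimplexMap_apply_of_injective s hs v]

/-- Every point of a topological simplex is interior to some face. -/
theorem exists_support_face {n : SimplexCategory} (t : TopSimplex n) :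
    ∃ (k : SimplexCategory) (s : k ⟶ n) (u : TopSimplex k),
      Function.Injective s.toOrderHom ∧ (∀ i, 0 < u i) ∧ topSimplexMap s u = t := by
  classical
  set S : Finset (Fin (n.len + 1)) := Finset.univ.filter (fun i => t i ≠ 0) with hS
  have hsum : ∑ i ∈ S, t i = 1 := by
    rw [hS, Finset.sum_filter_ne_zero]
    exact stdSimplex.sum_eq_one t
  have hcard : S.card = (S.card - 1) + 1 := by
    have : S.card ≠ 0 := by
      intro h
      rw [Finset.card_eq_zero.1 h] at hsum
      simp at hsum
    omega
  let e := S.orderEmbOfFin hcard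
  have he : Function.Injective e := e.injective
  have hemem : ∀ i, e i ∈ S := S.orderEmbOfFin_mem hcard
  have himg : Finset.univ.image e = S := S.image_orderEmbOfFin_univ hcard
  have hsum' : ∀ f : Fin (n.len + 1) → ℝ, ∑ i, f (e i) = ∑ i ∈ S, f i := fun f => by
    conv_rhs => rw [← himg]
    rw [Finset.sum_image (fun a _ b _ h => he h)]
  let u : TopSimplex ⦋S.card - 1⦌ :=
    ⟨fun i => t (e i), fun i => stdSimplex.zero_le t _, (hsum' t).trans hsum⟩
  let s : ⦋S.card - 1⦌ ⟶ n := SimplexCategory.Hom.mk e.toOrderHom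
  refine ⟨_, s, u, he, fun i => ?_, ?_⟩
  · exact lt_of_le_of_ne (stdSimplex.zero_le t _) (Finset.mem_filter.1 (hemem i)).2.symm
  · ext i
    by_cases hi : i ∈ S
    · rw [← himg, Finset.mem_image] at hi
      obtain ⟨j, -, rfl⟩ := hi
      exact topSimplexMap_apply_of_injective s he u j
    · have h0 : t i = 0 := by simpa [hS] using hi
      rw [h0]
      by_contra hne
      obtain ⟨j, hj⟩ := exists_of_topSimplexMap_apply_ne_zero s u hne
      exact hi (hj ▸ hemem j)

/-- A simplicial operator carrying an interior point to `s_* u`, with `u` interior to the face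
`s`, factors through `s` by a split epimorphism. -/
theorem exists_factor_support_face {m n k : SimplexCategory} (s : k ⟶ n)
    (hs : Function.Injective s.toOrderHom) (u : TopSimplex k) (hu : ∀ i, 0 < u i)
    (g : m ⟶ n) (v : TopSimplex m) (hv : ∀ i, 0 < v i)
    (h : topSimplexMap g v = topSimplexMap s u) :
    ∃ (e : m ⟶ k) (r : k ⟶ m), e ≫ s = g ∧ r ≫ e = 𝟙 k ∧ topSimplexMap e v = u := by
  -- All coordinates of `v` are positive, so every vertex hit by `g` carries weight in `s_* u` and
  -- hence lies in the image of `s`.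
  have hex : ∀ j, ∃ i, s.toOrderHom i = g.toOrderHom j := fun j =>
    exists_of_topSimplexMap_apply_ne_zero s u (h ▸ (topSimplexMap_apply_pos g v j (hv j)).ne')
  choose e he using hex
  have hsm : StrictMono s.toOrderHom := s.toOrderHom.monotone.strictMono_of_injective hs
  have hemono : Monotone e := fun a b hab => by
    rw [← hsm.le_iff_le, he, he]
    exact g.toOrderHom.monotone hab
  let E : m ⟶ k := SimplexCategory.Hom.mk ⟨e, hemono⟩
  have hEs : E ≫ s = g := by
    ext j : 3
    exact he j
  have hEv : topSimplexMap E v = u := topSimplexMap_injective s hs (by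
    rw [← topSimplexMap_comp, hEs, h])
  -- Conversely `u` is interior, so every vertex of the face receives weight from `v`; a monotone
  -- surjection of finite ordinals splits.
  have hsurj : Function.Surjective e := fun i =>
    exists_of_topSimplexMap_apply_ne_zero E v (hEv ▸ (hu i).ne')
  choose r hr using hsurj
  have hrmono : Monotone r := fun a b hab => by
    by_contra hlt
    rw [not_le] at hlt
    have := hemono hlt.le
    rw [hr, hr] at this
    obtain rfl := le_antisymm hab this
    exact lt_irrefl _ hlt
  refine ⟨E, SimplexCategory.Hom.mk ⟨r, hrmono⟩, hEs, ?_, hEv⟩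
  ext j : 3
  exact hr j

section Injectivity

variable {A X : SSet.{u}} (i : A ⟶ X)

/-- A set-level retraction of the realization of `X` onto that of a simplicial subset `A`, with
value `none` off `A`, evaluated at a point of a characteristic map. -/
noncomputable def subsetRetract {n : SimplexCategory} (x : X.obj (op n)) (t : TopSimplex n) :
    Option (SSet.toTop.obj A) :=
  open Classical in
  if h : ∃ a, i.app (op _) a = X.map (exists_support_face t).choose_spec.choose.op x then
    some (charMap h.choose (exists_support_face t).choose_spec.choose_spec.choose)
  else none

/-- The chosen support face is immaterial. Any other presentation `s_* v` with `v` interior factors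
through it by a split epimorphism `e`; the section of `e` carries `a` to a preimage on the support
face, and injectivity of `i` shows that `e` carries the chosen preimage back to `a`. -/
theorem subsetRetract_eq_some
    (hi : ∀ n : SimplexCategory, Function.Injective (i.app (op n))) {n k : SimplexCategory} (x : X.obj (op n)) (a : A.obj (op k))
    (s : k ⟶ n) (v : TopSimplex k) (hv : ∀ j, 0 < v j) (h : i.app (op k) a = X.map s.op x) :
    subsetRetract i x (topSimplexMap s v) = some (charMap a v) := by
  set t := topSimplexMap s v with ht
  obtain ⟨hs', hu', hsu⟩ := (exists_support_face t).choose_spec.choose_spec.choose_spec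
  obtain ⟨e, r, hes, hre, hev⟩ := exists_factor_support_face _ hs' _ hu' s v hv (ht ▸ hsu.symm)
  have hex : ∃ a, i.app (op _) a = X.map (exists_support_face t).choose_spec.choose.op x := by
    refine ⟨A.map r.op a, ?_⟩
    rw [sset_hom_map, h, ← sset_map_comp, ← hes, ← Category.assoc, hre, Category.id_comp]
  rw [subsetRetract, dif_pos hex, ← hev, ← charMap_map]
  have ha : A.map e.op hex.choose = a := hi _ (by
    rw [sset_hom_map, hex.choose_spec, ← sset_map_comp, hes, h])
  rw [ha]

theorem subsetRetract_eq_none {n k : SimplexCategory} (x : X.obj (op n))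
    (s : k ⟶ n) (v : TopSimplex k) (hv : ∀ j, 0 < v j)
    (h : ¬ ∃ a, i.app (op k) a = X.map s.op x) :
    subsetRetract i x (topSimplexMap s v) = none := by
  set t := topSimplexMap s v with ht
  obtain ⟨hs', hu', hsu⟩ := (exists_support_face t).choose_spec.choose_spec.choose_spec
  obtain ⟨e, r, hes, hre, hev⟩ := exists_factor_support_face _ hs' _ hu' s v hv (ht ▸ hsu.symm)
  rw [subsetRetract, dif_neg]
  rintro ⟨a, ha⟩
  exact h ⟨A.map e.op a, by rw [sset_hom_map, ha, ← sset_map_comp, hes]⟩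

/-- This compatibility with simplicial operators lets the pointwise recipe descend to the
realization of `X`. -/
theorem subsetRetract_map
    (hi : ∀ n : SimplexCategory, Function.Injective (i.app (op n))) {m n : SimplexCategory} (f : m ⟶ n) (x : X.obj (op n))
    (t : TopSimplex m) :
    subsetRetract i (X.map f.op x) t = subsetRetract i x (topSimplexMap f t) := by
  obtain ⟨k, s, v, hs, hv, rfl⟩ := exists_support_face t
  rw [← topSimplexMap_comp]
  by_cases h : ∃ a, i.app (op k) a = X.map (s ≫ f).op x
  · obtain ⟨a, ha⟩ := h
    rw [subsetRetract_eq_some i hi x a (s ≫ f) v hv ha,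
      subsetRetract_eq_some i hi (X.map f.op x) a s v hv (by rw [ha, sset_map_comp])]
  · rw [subsetRetract_eq_none i x (s ≫ f) v hv h,
      subsetRetract_eq_none i (X.map f.op x) s v hv (by rwa [← sset_map_comp])]

/-- The realization of a levelwise injective map of simplicial sets is injective. -/
theorem toTop_map_injective
    (hi : ∀ n : SimplexCategory, Function.Injective (i.app (op n))) : Function.Injective (SSet.toTop.map i) := by
  -- With the indiscrete topology on the target every function is continuous, so the universal
  -- property of the realization produces a set-level left inverse.
  let _ : TopologicalSpace (Option (SSet.toTop.obj A)) := ⊤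
  let Y : TopCat.{u} := TopCat.of (Option (SSet.toTop.obj A))
  let ret : SSet.toTop.obj X ⟶ Y := realDesc (toSSetMk (Y := Y)
    (fun n x => ⟨subsetRetract i x, continuous_top⟩)
    (fun f x t => subsetRetract_map i hi f x t))
  let incl : SSet.toTop.obj A ⟶ Y := TopCat.ofHom ⟨some, continuous_top⟩
  have h : SSet.toTop.map i ≫ ret = incl := by
    apply real_hom_ext
    intro n a t
    obtain ⟨k, s, v, hs, hv, rfl⟩ := exists_support_face t
    change ret (SSet.toTop.map i (charMap a _)) = some (charMap a _)
    rw [toTop_map_charMap, realDesc_charMap, singMap_toSSetMk, ← charMap_map]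
    exact subsetRetract_eq_some i hi _ (A.map s.op a) s v hv (sset_hom_map i s a)
  intro p q hpq
  have h' : ∀ p, ret (SSet.toTop.map i p) = some p := fun p =>
    congr_arg (fun k : SSet.toTop.obj A ⟶ Y => k p) h
  exact Option.some_injective _ ((h' p).symm.trans ((congr_arg ret hpq).trans (h' q)))

end Injectivity

/-! ### Extending maps into contractible spaces -/

/-- Let `D` be a compact convex polytope around `c`, given by finitely many linear inequalities
`ℓ k (d - c) ≤ 1`, whose boundary is the image of a compact space `T`. A map from `T` to a
contractible space which factors through the boundary extends to `D`. -/
theorem exists_extension_of_polytope {E : Type*} [AddCommGroup E] [Module ℝ E]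
    [TopologicalSpace E] [T2Space E] [ContinuousAdd E] [ContinuousSMul ℝ E] {K : Type*} [Fintype K]
    [Nonempty K] (ℓ : K → E →ₗ[ℝ] ℝ) (c : E) (A D : Set E)
    (hA : ∀ d ∈ A, ∀ r : ℝ, c + r • (d - c) ∈ A)
    (hD : ∀ d, d ∈ D ↔ d ∈ A ∧ ∀ k, ℓ k (d - c) ≤ 1)
    (hc : ∀ d ∈ A, (∀ k, ℓ k (d - c) ≤ 0) → d = c)
    {T : Type*} [TopologicalSpace T] [CompactSpace T] (j : T → E) (hj : Continuous j)
    (hjD : ∀ x, j x ∈ D) (hj1 : ∀ x, ∃ k, ℓ k (j x - c) = 1)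
    (hjs : ∀ d ∈ D, (∃ k, ℓ k (d - c) = 1) → ∃ x, j x = d)
    {V : Type*} [TopologicalSpace V] [ContractibleSpace V] (f : T → V) (hf : Continuous f)
    (hfj : ∀ x y, j x = j y → f x = f y) :
    ∃ F : C(D, V), ∀ x, F ⟨j x, hjD x⟩ = f x := by
  obtain ⟨v₀, ⟨H⟩⟩ := (contractible_iff_id_nullhomotopic V).1 inferInstance
  rcases isEmpty_or_nonempty T with hT | ⟨⟨x₀⟩⟩
  · exact ⟨ContinuousMap.const _ v₀, fun x => hT.elim x⟩
  have hjA : ∀ x, j x ∈ A := fun x => ((hD _).1 (hjD x)).1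
  have hjl : ∀ x k, ℓ k (j x - c) ≤ 1 := fun x => ((hD _).1 (hjD x)).2
  -- Polar coordinates: `s = 0` is the boundary and `s = 1` the center. The extension will send `q
  -- (x, s)` to `H (s, f x)`, where `H` contracts `V` to `v₀`.
  let q : T × unitInterval → E := fun p => c + (1 - (p.2 : ℝ)) • (j p.1 - c)
  have hqc : Continuous q := by
    have h1 : Continuous fun p : T × unitInterval => j p.1 - c := by
      simp_rw [sub_eq_add_neg]
      exact (hj.comp continuous_fst).add continuous_const
    exact continuous_const.add ((continuous_const.sub
      (continuous_subtype_val.comp continuous_snd)).smul h1)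
  have hql : ∀ p k, ℓ k (q p - c) = (1 - (p.2 : ℝ)) * ℓ k (j p.1 - c) := fun p k => by
    simp [q]
  have hqD : ∀ p, q p ∈ D := fun p => (hD _).2 ⟨hA _ (hjA _) _, fun k => by
    rw [hql]
    have := hjl p.1 k
    nlinarith [p.2.2.1, p.2.2.2]⟩
  let Q : C(T × unitInterval, D) := ⟨fun p => ⟨q p, hqD p⟩, hqc.subtype_mk _⟩
  have hQs : Function.Surjective Q := by
    rintro ⟨d, hd⟩
    by_cases hdc : d = c
    · refine ⟨(x₀, 1), Subtype.ext ?_⟩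
      simp [Q, q, hdc]
    · obtain ⟨hdA, hdl⟩ := (hD d).1 hd
      -- The maximum `g` of the functionals is the radial coordinate of `d`: dividing by it moves
      -- `d` to the boundary, and `d` is reached at `s = 1 - g`.
      obtain ⟨k, -, hk⟩ := Finset.exists_max_image Finset.univ (fun k => ℓ k (d - c))
        Finset.univ_nonempty
      have hg : 0 < ℓ k (d - c) := by
        by_contra hle
        exact hdc (hc d hdA fun k' => (hk k' (Finset.mem_univ _)).trans (not_lt.1 hle))
      set g := ℓ k (d - c) with hgdef
      obtain ⟨x, hx⟩ := hjs (c + g⁻¹ • (d - c)) ((hD _).2 ⟨hA d hdA _, fun k' => by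
        have := hk k' (Finset.mem_univ _)
        simp only [add_sub_cancel_left, map_smul, smul_eq_mul]
        rw [inv_mul_le_iff₀ hg]
        simpa using this⟩) ⟨k, by
          simp only [add_sub_cancel_left, map_smul, smul_eq_mul]
          exact inv_mul_cancel₀ hg.ne'⟩
      refine ⟨(x, ⟨1 - g, by linarith [hdl k], by linarith⟩), Subtype.ext ?_⟩
      simp only [Q, q, ContinuousMap.coe_mk, hx, add_sub_cancel_left, sub_sub_cancel, smul_smul,
        mul_inv_cancel₀ hg.ne', one_smul, add_sub_cancel]
  -- Comparing at a functional equal to `1` at `j p.1` shows, by symmetry, that a point determines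
  -- `s`. It also determines `j x` unless `s = 1`, where `H` is constant.
  have hle : ∀ p p', Q p = Q p' → 1 - (p.2 : ℝ) ≤ 1 - (p'.2 : ℝ) := fun p p' h => by
    obtain ⟨k, hk⟩ := hj1 p.1
    have h1 := hql p k
    rw [hk, mul_one, show q p = q p' from congr_arg Subtype.val h, hql] at h1
    have := hjl p'.1 k
    nlinarith [p'.2.2.2]
  -- `T × [0,1]` is compact and `D` is Hausdorff, so `Q` is closed.
  have hquot : Topology.IsQuotientMap Q := Q.continuous.isClosedMap.isQuotientMap Q.continuous hQs
  let g : C(T × unitInterval, V) :=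
    ⟨fun p => H (p.2, f p.1), H.continuous.comp (continuous_snd.prodMk (hf.comp continuous_fst))⟩
  have hfac : Function.FactorsThrough g Q := by
    intro p p' h
    have hs : (p.2 : ℝ) = p'.2 := by linarith [hle p p' h, hle p' p h.symm]
    have hs' : p.2 = p'.2 := Subtype.ext hs
    change H (p.2, f p.1) = H (p'.2, f p'.1)
    by_cases h1 : (p.2 : ℝ) = 1
    · have h1' : p.2 = 1 := Subtype.ext h1
      rw [← hs', h1', H.apply_one, H.apply_one]
      rfl
    · have hq : q p = q p' := congr_arg Subtype.val h
      have hj' : j p.1 = j p'.1 := by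
        have h2 := add_left_cancel hq
        rw [← hs] at h2
        have h3 : (1 - (p.2 : ℝ)) ≠ 0 := fun h0 => h1 (by linarith)
        exact sub_left_injective (smul_right_injective E h3 h2)
      rw [hs', hfj _ _ hj']
  refine ⟨hquot.lift g hfac, fun x => ?_⟩
  have h0 : (⟨j x, hjD x⟩ : D) = Q (x, 0) := Subtype.ext (by simp [Q, q])
  rw [h0]
  change (hquot.lift g hfac).comp Q (x, 0) = f x
  rw [hquot.lift_comp g hfac]
  change H (0, f x) = f x
  rw [H.apply_zero]
  rfl

/-! ### Filling boundaries of simplices and prisms in contractible spaces -/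

/-- A simplicial operator whose image is a proper face. -/
def IsFace {m n : SimplexCategory} (f : m ⟶ n) : Prop :=
  ¬ Function.Surjective f.toOrderHom

theorem IsFace.comp {k m n : SimplexCategory} {f : m ⟶ n} (hf : IsFace f) (g : k ⟶ m) :
    IsFace (g ≫ f) := fun h => hf fun i => by
  obtain ⟨j, hj⟩ := h i
  exact ⟨g.toOrderHom j, hj⟩

/-- A map from the boundary of the standard `n`-simplex to `S`. -/
structure BoundaryFamily (S : SSet.{u}) (n : SimplexCategory) where
  val : ∀ {m : SimplexCategory} (f : m ⟶ n), IsFace f → S.obj (op m)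
  map_val : ∀ {k m : SimplexCategory} (g : k ⟶ m) (f : m ⟶ n) (hf : IsFace f),
    S.map g.op (val f hf) = val (g ≫ f) (hf.comp g)

/-- The map of simplicial sets associated with a boundary family. -/
def BoundaryFamily.hom {S : SSet.{u}} {n : SimplexCategory} (b : BoundaryFamily S n) :
    (SSet.boundary.{u} n.len : SSet.{u}) ⟶ S where
  app m := ↾fun x => b.val (SSet.stdSimplex.objEquiv x.1) x.2
  naturality m k g := by
    ext x
    exact (b.map_val g.unop (SSet.stdSimplex.objEquiv x.1) x.2).symm

/-- The boundary simplex given by a face operator. -/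
def boundarySimplex {m n : SimplexCategory} (f : m ⟶ n) (hf : IsFace f) :
    (SSet.boundary.{u} n.len : SSet.{u}).obj (op m) :=
  ⟨SSet.stdSimplex.objEquiv.symm f, hf⟩

theorem BoundaryFamily.hom_boundarySimplex {S : SSet.{u}} {n : SimplexCategory}
    (b : BoundaryFamily S n) {m : SimplexCategory} (f : m ⟶ n) (hf : IsFace f) :
    b.hom.app (op m) (boundarySimplex f hf) = b.val f hf := rfl

/-- The family factors through the realization of the boundary, which injects into that of the
simplex. So its value depends only on the point, not on the face used to reach it. -/
theorem BoundaryFamily.singMap_val_eq {V : TopCat.{u}} {n : SimplexCategory}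
    (b : BoundaryFamily (TopCat.toSSet.obj V) n) {m m' : SimplexCategory} (f : m ⟶ n)
    (hf : IsFace f) (f' : m' ⟶ n) (hf' : IsFace f') (t : TopSimplex m) (t' : TopSimplex m')
    (h : topSimplexMap f t = topSimplexMap f' t') :
    singMap (b.val f hf) t = singMap (b.val f' hf') t' := by
  rw [← b.hom_boundarySimplex f hf, ← b.hom_boundarySimplex f' hf', ← realDesc_charMap,
    ← realDesc_charMap]
  congr 1
  apply toTop_map_injective (SSet.boundary.{u} n.len).ι (fun m => Subtype.val_injective)
  rw [toTop_map_charMap, toTop_map_charMap]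
  have key : ∀ {m : SimplexCategory} (f : m ⟶ n) (hf : IsFace f) (t : TopSimplex m),
      charMap ((SSet.boundary.{u} n.len).ι.app (op m) (boundarySimplex f hf)) t =
      charMap (X := SSet.stdSimplex.obj n) (n := n) (SSet.stdSimplex.objEquiv.symm (𝟙 n))
        (topSimplexMap f t) := fun f hf t => by
    rw [← charMap_map]
    congr 2
    exact SSet.stdSimplex.objEquiv.injective (Category.comp_id f).symm
  rw [key, key, h]

/-- The points of the faces of a topological simplex. -/
abbrev FacePoint (n : SimplexCategory) : Type :=
  Σ a : {a : Σ k : Fin (n.len + 1), (⦋k.1⦌ ⟶ n) // IsFace a.2}, TopSimplex ⦋a.1.1.1⦌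

/-- Bounding the dimension of the source by that of `n` leaves finitely many operators, hence a
finite disjoint union of compact simplices. -/
instance (n : SimplexCategory) : CompactSpace (FacePoint n) := by
  have : ∀ k : Fin (n.len + 1), Finite (⦋k.1⦌ ⟶ n) := fun k =>
    Finite.of_injective (fun f : ⦋k.1⦌ ⟶ n => (f.toOrderHom : Fin _ → Fin _)) fun f g h => by
      ext i : 3
      exact congr_fun h i
  infer_instance

/-- The point of the topological simplex given by a point of a face. -/
noncomputable def FacePoint.pt {n : SimplexCategory} (x : FacePoint n) : TopSimplex n :=
  topSimplexMap x.1.1.2 x.2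

theorem FacePoint.continuous_pt {n : SimplexCategory} :
    Continuous (FacePoint.pt : FacePoint n → TopSimplex n) :=
  continuous_sigma fun a => (topSimplexMap a.1.2).continuous

theorem exists_topSimplexMap_apply_eq_zero {m n : SimplexCategory} (f : m ⟶ n) (hf : IsFace f)
    (t : TopSimplex m) : ∃ i, topSimplexMap f t i = 0 := by
  obtain ⟨i, hi⟩ := not_forall.1 hf
  exact ⟨i, by_contra fun h => hi (exists_of_topSimplexMap_apply_ne_zero f t h)⟩

theorem FacePoint.exists_pt_eq {n : SimplexCategory} (p : TopSimplex n) (i : Fin (n.len + 1))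
    (hi : p i = 0) : ∃ x : FacePoint n, x.pt = p := by
  obtain ⟨k, s, u, hs, hu, rfl⟩ := exists_support_face p
  have hcard : k.len < n.len + 1 := by
    simpa using Fintype.card_le_of_injective _ hs
  have hface : IsFace s := fun h => by
    obtain ⟨j, rfl⟩ := h i
    exact (topSimplexMap_apply_pos s u j (hu j)).ne' hi
  exact ⟨⟨⟨⟨⟨k.len, hcard⟩, s⟩, hface⟩, u⟩, rfl⟩

/-- The map on faces determined by a boundary family of singular simplices. -/
noncomputable def BoundaryFamily.onFaces {V : TopCat.{u}} {n : SimplexCategory}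
    (b : BoundaryFamily (TopCat.toSSet.obj V) n) (x : FacePoint n) : V :=
  singMap (b.val x.1.1.2 x.1.2) x.2

theorem BoundaryFamily.continuous_onFaces {V : TopCat.{u}} {n : SimplexCategory}
    (b : BoundaryFamily (TopCat.toSSet.obj V) n) : Continuous b.onFaces :=
  continuous_sigma fun a => (singMap (b.val a.1.2 a.2)).continuous

/-- The defining linear functionals of the standard simplex, centered at the barycenter. -/
noncomputable def simplexFunctional (n : ℕ) (i : Fin (n + 1)) : (Fin (n + 1) → ℝ) →ₗ[ℝ] ℝ :=
  (-(n + 1 : ℝ)) • LinearMap.proj i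

theorem simplexFunctional_sub (n : ℕ) (i : Fin (n + 1)) (d : Fin (n + 1) → ℝ) :
    simplexFunctional n i (d - fun _ => (n + 1 : ℝ)⁻¹) = 1 - (n + 1) * d i := by
  have : (n + 1 : ℝ) ≠ 0 := by positivity
  simp only [simplexFunctional, LinearMap.smul_apply, LinearMap.proj_apply, Pi.sub_apply,
    smul_eq_mul]
  field_simp
  ring

theorem simplexFunctional_sub_eq_one (n : ℕ) (i : Fin (n + 1)) (d : Fin (n + 1) → ℝ) :
    simplexFunctional n i (d - fun _ => (n + 1 : ℝ)⁻¹) = 1 ↔ d i = 0 := by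
  have : (n + 1 : ℝ) ≠ 0 := by positivity
  rw [simplexFunctional_sub]
  simp [this]

theorem simplexFunctional_sub_le_one (n : ℕ) (i : Fin (n + 1)) (d : Fin (n + 1) → ℝ) :
    simplexFunctional n i (d - fun _ => (n + 1 : ℝ)⁻¹) ≤ 1 ↔ 0 ≤ d i := by
  have : (0 : ℝ) < n + 1 := by positivity
  rw [simplexFunctional_sub, sub_le_self_iff, mul_nonneg_iff_of_pos_left this]

/-- Every coordinate is at least `1/(n+1)` and they sum to `1`, so all these inequalities are
equalities. -/
theorem eq_barycenter_of_simplexFunctional_le (n : ℕ) (d : Fin (n + 1) → ℝ) (hd : ∑ i, d i = 1)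
    (h : ∀ i, simplexFunctional n i (d - fun _ => (n + 1 : ℝ)⁻¹) ≤ 0) :
    d = fun _ => (n + 1 : ℝ)⁻¹ := by
  have hpos : (0 : ℝ) < n + 1 := by positivity
  have hle : ∀ i, (n + 1 : ℝ)⁻¹ ≤ d i := fun i => by
    have := h i
    rw [simplexFunctional_sub] at this
    rw [inv_le_iff_one_le_mul₀' hpos]
    linarith
  have hsum : ∑ i : Fin (n + 1), (n + 1 : ℝ)⁻¹ = ∑ i, d i := by
    rw [hd]
    simp [hpos.ne']
  funext i
  exact ((Finset.sum_eq_sum_iff_of_le fun i _ => hle i).1 hsum i (Finset.mem_univ i)).symm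

theorem sum_barycenter_add_smul (n : ℕ) (d : Fin (n + 1) → ℝ) (hd : ∑ i, d i = 1) (r : ℝ) :
    ∑ i, ((fun _ => (n + 1 : ℝ)⁻¹) + r • (d - fun _ => (n + 1 : ℝ)⁻¹) : Fin (n + 1) → ℝ) i = 1 := by
  have hpos : (n + 1 : ℝ) ≠ 0 := by positivity
  simp [Finset.sum_add_distrib, ← Finset.mul_sum, hd, hpos]

/-- Singular simplices of a contractible space can be filled. -/
theorem exists_fill_of_contractible {V : TopCat.{u}} [ContractibleSpace V] {n : SimplexCategory}
    (b : BoundaryFamily (TopCat.toSSet.obj V) n) :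
    ∃ y : (TopCat.toSSet.obj V).obj (op n),
      ∀ {m : SimplexCategory} (f : m ⟶ n) (hf : IsFace f),
        (TopCat.toSSet.obj V).map f.op y = b.val f hf := by
  obtain ⟨F, hF⟩ := exists_extension_of_polytope (simplexFunctional n.len)
    (fun _ => (n.len + 1 : ℝ)⁻¹) {d | ∑ i, d i = 1} (stdSimplex ℝ (Fin (n.len + 1)))
    (fun d hd r => sum_barycenter_add_smul n.len d hd r)
    (fun d => by
      simp only [simplexFunctional_sub_le_one]
      exact and_comm)
    (fun d hd => eq_barycenter_of_simplexFunctional_le n.len d hd)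
    (fun x : FacePoint n => (x.pt : Fin (n.len + 1) → ℝ))
    (continuous_subtype_val.comp FacePoint.continuous_pt)
    (fun x => x.pt.2)
    (fun x => by
      obtain ⟨i, hi⟩ := exists_topSimplexMap_apply_eq_zero _ x.1.2 x.2
      exact ⟨i, (simplexFunctional_sub_eq_one _ _ _).2 hi⟩)
    (fun d hd ⟨k, hk⟩ => by
      obtain ⟨x, hx⟩ := FacePoint.exists_pt_eq ⟨d, hd⟩ k ((simplexFunctional_sub_eq_one _ _ _).1 hk)
      exact ⟨x, congr_arg Subtype.val hx⟩)
    b.onFaces b.continuous_onFaces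
    (fun x y h => b.singMap_val_eq _ _ _ _ _ _ (Subtype.ext h))
  obtain ⟨y, hy⟩ := singMap_surjective F
  refine ⟨y, fun {m} f hf => singMap_injective ?_⟩
  ext t
  obtain ⟨i, hi⟩ := exists_topSimplexMap_apply_eq_zero f hf t
  obtain ⟨x, hx⟩ := FacePoint.exists_pt_eq _ i hi
  rw [singMap_map, hy, ← hx]
  exact (hF x).trans (b.singMap_val_eq _ _ _ _ _ _ hx)

/-- The space of paths in `V`. -/
abbrev pathSpace (V : TopCat.{u}) : TopCat.{u} := TopCat.of C(unitInterval, V)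

/-- Singular simplices of the path space of a contractible space can be filled, with prescribed
endpoints. -/
theorem exists_fill_path_of_contractible {V : TopCat.{u}} [ContractibleSpace V]
    {n : SimplexCategory} (b : BoundaryFamily (TopCat.toSSet.obj (pathSpace V)) n)
    (e₀ e₁ : C(TopSimplex n, V))
    (h₀ : ∀ {m : SimplexCategory} (f : m ⟶ n) (hf : IsFace f) (t : TopSimplex m),
      (singMap (b.val f hf) t : C(unitInterval, V)) 0 = e₀ (topSimplexMap f t))
    (h₁ : ∀ {m : SimplexCategory} (f : m ⟶ n) (hf : IsFace f) (t : TopSimplex m),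
      (singMap (b.val f hf) t : C(unitInterval, V)) 1 = e₁ (topSimplexMap f t)) :
    ∃ y : (TopCat.toSSet.obj (pathSpace V)).obj (op n),
      (∀ {m : SimplexCategory} (f : m ⟶ n) (hf : IsFace f),
        (TopCat.toSSet.obj (pathSpace V)).map f.op y = b.val f hf) ∧
      ∀ t, (singMap y t : C(unitInterval, V)) 0 = e₀ t ∧
        (singMap y t : C(unitInterval, V)) 1 = e₁ t := by
  let bary : Fin (n.len + 1) → ℝ := fun _ => (n.len + 1 : ℝ)⁻¹
  let E := (Fin (n.len + 1) → ℝ) × ℝ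
  -- The prism `Δⁿ × [0,1]` around (barycenter, 1/2). The factors `2` and `-2` normalize the
  -- functionals to equal `1` on the top and the bottom.
  let ℓ : (Fin (n.len + 1) ⊕ Bool) → E →ₗ[ℝ] ℝ :=
    Sum.elim (fun i => (simplexFunctional n.len i).comp (LinearMap.fst ℝ _ _))
      (fun ε => (bif ε then (2 : ℝ) else -2) • LinearMap.snd ℝ _ _)
  have hl0 : ∀ (d : E) i, ℓ (Sum.inl i) (d - (bary, 1 / 2)) =
      simplexFunctional n.len i (d.1 - bary) := fun d i => rfl
  have hl1 : ∀ (d : E), ℓ (Sum.inr true) (d - (bary, 1 / 2)) = 2 * d.2 - 1 := fun d => by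
    change 2 * (d.2 - 1 / 2) = _
    ring
  have hl2 : ∀ (d : E), ℓ (Sum.inr false) (d - (bary, 1 / 2)) = 1 - 2 * d.2 := fun d => by
    change -2 * (d.2 - 1 / 2) = _
    ring
  let D : Set E := {d | d.1 ∈ stdSimplex ℝ (Fin (n.len + 1)) ∧ d.2 ∈ unitInterval}
  -- The boundary of the prism: the walls, where the family of paths is given, and the two ends,
  -- where `e₀` and `e₁` are given.
  let T := (FacePoint n × unitInterval) ⊕ (TopSimplex n × Bool)
  let ε : Bool → unitInterval := fun x => bif x then 1 else 0
  let e : Bool → C(TopSimplex n, V) := fun x => bif x then e₁ else e₀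
  let j : T → TopSimplex n × unitInterval :=
    Sum.elim (fun x => (x.1.pt, x.2)) (fun x => (x.1, ε x.2))
  have hjc : Continuous j := Continuous.sumElim
    ((FacePoint.continuous_pt.comp continuous_fst).prodMk continuous_snd)
    (continuous_fst.prodMk ((continuous_of_discreteTopology (f := ε)).comp continuous_snd))
  let f : T → V := Sum.elim (fun x => (b.onFaces x.1 : C(unitInterval, V)) x.2)
    (fun x => e x.2 x.1)
  have hfc : Continuous f := by
    refine Continuous.sumElim ?_ ?_
    · exact continuous_eval.comp
        ((b.continuous_onFaces.comp continuous_fst).prodMk continuous_snd)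
    · exact continuous_eval.comp
        (((continuous_of_discreteTopology (f := e)).comp continuous_snd).prodMk continuous_fst)
  have hε : ∀ (x : FacePoint n) (β : Bool), (b.onFaces x : C(unitInterval, V)) (ε β) =
      e β x.pt := by
    rintro x (_ | _)
    · exact h₀ _ _ _
    · exact h₁ _ _ _
  have hεinj : Function.Injective ε := by
    rintro (_ | _) (_ | _) h
    · rfl
    · exact absurd (congr_arg Subtype.val h) zero_ne_one
    · exact absurd (congr_arg Subtype.val h) one_ne_zero
    · rfl
  have hfj : ∀ x y, j x = j y → f x = f y := by
    rintro (⟨x, s⟩ | ⟨p, β⟩) (⟨y, s'⟩ | ⟨p', β'⟩) h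
    · obtain rfl : s = s' := congr_arg Prod.snd h
      have hxy : x.pt = y.pt := congr_arg Prod.fst h
      exact congr_arg (fun γ : C(unitInterval, V) => γ s) (b.singMap_val_eq _ _ _ _ _ _ hxy)
    · obtain rfl : s = ε β' := congr_arg Prod.snd h
      obtain rfl : x.pt = p' := congr_arg Prod.fst h
      exact hε x β'
    · obtain rfl : ε β = s' := congr_arg Prod.snd h
      obtain rfl : p = y.pt := congr_arg Prod.fst h
      exact (hε y β).symm
    · obtain rfl : β = β' := hεinj (congr_arg Prod.snd h)
      obtain rfl : p = p' := congr_arg Prod.fst h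
      rfl
  obtain ⟨F, hF⟩ := exists_extension_of_polytope ℓ (bary, 1 / 2) {d | ∑ i, d.1 i = 1} D
    (fun d hd r => sum_barycenter_add_smul n.len d.1 hd r)
    (fun d => by
      simp only [Sum.forall, Bool.forall_bool, hl0, hl1, hl2]
      simp only [bary, simplexFunctional_sub_le_one]
      constructor
      · rintro ⟨⟨h1, h2⟩, h3, h4⟩
        exact ⟨h2, h1, by linarith, by linarith⟩
      · rintro ⟨h2, h1, h3, h4⟩
        exact ⟨⟨h1, h2⟩, by linarith, by linarith⟩)
    (fun d hd h => by
      simp only [Sum.forall, Bool.forall_bool, hl0, hl1, hl2] at h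
      refine Prod.ext (eq_barycenter_of_simplexFunctional_le n.len d.1 hd h.1) ?_
      change d.2 = 1 / 2
      linarith [h.2.1, h.2.2])
    (fun x : T => (((j x).1 : Fin (n.len + 1) → ℝ), ((j x).2 : ℝ)))
    ((continuous_subtype_val.comp (continuous_fst.comp hjc)).prodMk
      (continuous_subtype_val.comp (continuous_snd.comp hjc)))
    (fun x => ⟨(j x).1.2, (j x).2.2⟩)
    (by
      rintro (⟨x, s⟩ | ⟨p, _ | _⟩)
      · obtain ⟨i, hi⟩ := exists_topSimplexMap_apply_eq_zero _ x.1.2 x.2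
        exact ⟨Sum.inl i, (simplexFunctional_sub_eq_one _ _ _).2 hi⟩
      · exact ⟨Sum.inr false, by rw [hl2]; simp [j, ε]⟩
      · exact ⟨Sum.inr true, by rw [hl1]; norm_num [j, ε]⟩)
    (by
      rintro ⟨p, s⟩ ⟨hp, hs⟩ ⟨i | _ | _, hk⟩
      · obtain ⟨x, hx⟩ := FacePoint.exists_pt_eq ⟨p, hp⟩ i
          ((simplexFunctional_sub_eq_one _ _ _).1 hk)
        exact ⟨Sum.inl (x, ⟨s, hs⟩), Prod.ext (congr_arg Subtype.val hx) rfl⟩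
      · rw [hl2] at hk
        refine ⟨Sum.inr (⟨p, hp⟩, false), Prod.ext rfl ?_⟩
        change (0 : ℝ) = s
        change 1 - 2 * s = 1 at hk
        linarith
      · rw [hl1] at hk
        refine ⟨Sum.inr (⟨p, hp⟩, true), Prod.ext rfl ?_⟩
        change (1 : ℝ) = s
        change 2 * s - 1 = 1 at hk
        linarith)
    f hfc
    (fun x y h => hfj x y (Prod.ext (Subtype.ext (congr_arg Prod.fst h))
      (Subtype.ext (congr_arg Prod.snd h))))
  let toD : C(TopSimplex n × unitInterval, D) :=
    ⟨fun p => ⟨(p.1.1, p.2.1), p.1.2, p.2.2⟩, by fun_prop⟩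
  have hFj : ∀ x, F (toD (j x)) = f x := hF
  -- Currying turns the filled prism into a singular simplex of the path space.
  obtain ⟨y, hy⟩ := singMap_surjective (Y := pathSpace V) (F.comp toD).curry
  have hyF : ∀ t s, (singMap y t : C(unitInterval, V)) s = F (toD (t, s)) := fun t s => by
    rw [hy]
    rfl
  refine ⟨y, fun {m} g hg => singMap_injective ?_, fun t => ⟨?_, ?_⟩⟩
  · refine ContinuousMap.ext fun t => ?_
    obtain ⟨i, hi⟩ := exists_topSimplexMap_apply_eq_zero g hg t
    obtain ⟨x, hx⟩ := FacePoint.exists_pt_eq _ i hi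
    rw [singMap_map]
    refine Eq.trans (ContinuousMap.ext fun s => ?_) (b.singMap_val_eq _ x.1.2 g hg x.2 t hx)
    rw [hyF, ← hx]
    exact hFj (Sum.inl (x, s))
  · rw [hyF]
    exact hFj (Sum.inr (t, false))
  · rw [hyF]
    exact hFj (Sum.inr (t, true))

/-! ### Equivariant maps of simplicial sets, constructed simplex by simplex -/

section EquivariantExtension

variable {G : Type u} {X S : SSet.{u}} (a : G → (X ⟶ X)) (b : G → (S ⟶ S))
  (R : ∀ n : SimplexCategory, X.obj (op n) → S.obj (op n) → Prop)

/-- The graph of an equivariant map, satisfying the relation `R`, defined on a `G`-stable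
simplicial subset of `X`. -/
structure IsPartialMap (Γ : Set (Σ n : SimplexCategory, X.obj (op n) × S.obj (op n))) :
    Prop where
  rel : ∀ {n x y}, ⟨n, x, y⟩ ∈ Γ → R n x y
  act : ∀ (g : G) {n x y}, ⟨n, x, y⟩ ∈ Γ → ⟨n, (a g).app (op n) x, (b g).app (op n) y⟩ ∈ Γ
  map : ∀ {m n : SimplexCategory} (f : m ⟶ n) {x y}, ⟨n, x, y⟩ ∈ Γ →
    ⟨m, X.map f.op x, S.map f.op y⟩ ∈ Γ
  func : ∀ {n x y y'}, ⟨n, x, y⟩ ∈ Γ → ⟨n, x, y'⟩ ∈ Γ → y = y'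

theorem exists_maximal_isPartialMap : ∃ Γ, Maximal (IsPartialMap a b R) Γ := by
  refine zorn_subset {Γ | IsPartialMap a b R Γ} fun c hc hchain =>
    ⟨⋃₀ c, ?_, fun s hs => Set.subset_sUnion_of_mem hs⟩
  refine ⟨?_, ?_, ?_, ?_⟩
  · rintro n x y ⟨Γ, hΓ, h⟩
    exact (hc hΓ).rel h
  · rintro g n x y ⟨Γ, hΓ, h⟩
    exact ⟨Γ, hΓ, (hc hΓ).act g h⟩
  · rintro m n f x y ⟨Γ, hΓ, h⟩
    exact ⟨Γ, hΓ, (hc hΓ).map f h⟩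
  · rintro n x y y' ⟨Γ, hΓ, h⟩ ⟨Γ', hΓ', h'⟩
    rcases hchain.total hΓ hΓ' with hle | hle
    · exact (hc hΓ').func (hle h) h'
    · exact (hc hΓ).func h (hle h')

theorem exists_section_of_not_isFace {m n : SimplexCategory} (f : m ⟶ n) (hf : ¬ IsFace f) :
    ∃ r : n ⟶ m, r ≫ f = 𝟙 n := by
  have : Epi f := SimplexCategory.epi_iff_surjective.2 (not_not.1 hf)
  obtain ⟨⟨h⟩⟩ := isSplitEpi_of_epi f
  exact ⟨h.section_, h.id⟩

variable {a b R}

/-- A face operator factors through a coface, so the restriction comes from a simplex one dimension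
lower, already in the domain. In dimension zero there are no face operators. -/
theorem IsPartialMap.exists_of_isFace {Γ : Set (Σ n : SimplexCategory, X.obj (op n) × S.obj (op n))}
    (hΓ : IsPartialMap a b R Γ) {k : ℕ}
    (ih : ∀ l < k, ∀ x : X.obj (op ⦋l⦌), ∃ y, ⟨⦋l⦌, x, y⟩ ∈ Γ) (x : X.obj (op ⦋k⦌))
    {m : SimplexCategory} (f : m ⟶ ⦋k⦌) (hf : IsFace f) : ∃ y, ⟨m, X.map f.op x, y⟩ ∈ Γ := by
  rcases k with _ | k
  · exact absurd (fun i => ⟨0, Subsingleton.elim (α := Fin 1) _ _⟩) hf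
  · obtain ⟨i, θ, rfl⟩ := SimplexCategory.eq_comp_δ_of_not_surjective f hf
    obtain ⟨y, hy⟩ := ih k (Nat.lt_succ_self k) (X.map (SimplexCategory.δ i).op x)
    exact ⟨S.map θ.op y, by rw [sset_map_comp]; exact hΓ.map θ hy⟩

/-- An equivariant map satisfying a relation `R` exists if boundaries can be filled within `R`
and if stabilizers of simplices act trivially on the simplices related to them. -/
theorem exists_equivariant_map [Group G]
    (a_one : ∀ n (x : X.obj (op n)), (a 1).app (op n) x = x)
    (a_mul : ∀ g h n (x : X.obj (op n)),
      (a (g * h)).app (op n) x = (a g).app (op n) ((a h).app (op n) x))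
    (b_one : ∀ n (y : S.obj (op n)), (b 1).app (op n) y = y)
    (b_mul : ∀ g h n (y : S.obj (op n)),
      (b (g * h)).app (op n) y = (b g).app (op n) ((b h).app (op n) y))
    (R_act : ∀ g n x y, R n x y → R n ((a g).app (op n) x) ((b g).app (op n) y))
    (R_stab : ∀ g n x y, R n x y → (a g).app (op n) x = x → (b g).app (op n) y = y)
    (R_degen : ∀ {m n : SimplexCategory} (f : m ⟶ n) (r : n ⟶ m), r ≫ f = 𝟙 n →
      ∀ x y, R n x y → R m (X.map f.op x) (S.map f.op y))
    (R_fill : ∀ (n : SimplexCategory) (x : X.obj (op n)) (d : BoundaryFamily S n),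
      (∀ {m : SimplexCategory} (f : m ⟶ n) (hf : IsFace f), R m (X.map f.op x) (d.val f hf)) →
      ∃ y, R n x y ∧ ∀ {m : SimplexCategory} (f : m ⟶ n) (hf : IsFace f),
        S.map f.op y = d.val f hf) :
    ∃ φ : X ⟶ S, (∀ g n (x : X.obj (op n)),
      φ.app (op n) ((a g).app (op n) x) = (b g).app (op n) (φ.app (op n) x)) ∧
      ∀ n x, R n x (φ.app (op n) x) := by
  obtain ⟨Γ, hΓ, hmax⟩ := exists_maximal_isPartialMap a b R
  have a_inv : ∀ g n (x : X.obj (op n)), (a g⁻¹).app (op n) ((a g).app (op n) x) = x :=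
    fun g n x => by rw [← a_mul, inv_mul_cancel, a_one]
  have hdom : ∀ (k : ℕ) (x : X.obj (op ⦋k⦌)), ∃ y, ⟨⦋k⦌, x, y⟩ ∈ Γ := by
    intro k
    induction k using Nat.strong_induction_on with
    | _ k ih =>
    intro x
    by_contra hx
    -- A simplex missing from the domain in the lowest possible dimension has only nondegenerate
    -- translates: lower simplices, their degeneracies and their translates are all in the domain.
    have hdeg : ∀ l < k, ∀ (f : (⦋k⦌ : SimplexCategory) ⟶ ⦋l⦌) (z : X.obj (op ⦋l⦌)) (g : G),
        X.map f.op z ≠ (a g).app (op ⦋k⦌) x := by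
      intro l hl f z g h
      obtain ⟨y, hy⟩ := ih l hl z
      have := hΓ.act g⁻¹ (hΓ.map f hy)
      rw [h, a_inv] at this
      exact hx ⟨_, this⟩
    have hnd : ∀ g : G, (a g).app (op ⦋k⦌) x ∈ X.nonDegenerate k := by
      rintro g ⟨l, hl, f, z, hz⟩
      exact hdeg l hl f z g hz
    let d : BoundaryFamily S ⦋k⦌ :=
      { val := fun f hf => (hΓ.exists_of_isFace ih x f hf).choose
        map_val := fun g f hf => by
          refine hΓ.func ?_ (hΓ.exists_of_isFace ih x (g ≫ f) (hf.comp g)).choose_spec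
          rw [sset_map_comp]
          exact hΓ.map g (hΓ.exists_of_isFace ih x f hf).choose_spec }
    have hd : ∀ {m : SimplexCategory} (f : m ⟶ ⦋k⦌) (hf : IsFace f),
        ⟨m, X.map f.op x, d.val f hf⟩ ∈ Γ := fun f hf =>
      (hΓ.exists_of_isFace ih x f hf).choose_spec
    obtain ⟨y, hxy, hyd⟩ := R_fill ⦋k⦌ x d (fun f hf => hΓ.rel (hd f hf))
    have hface : ∀ {m : SimplexCategory} (g : G) (f : m ⟶ ⦋k⦌), IsFace f →
        ⟨m, (a g).app (op m) (X.map f.op x), (b g).app (op m) (S.map f.op y)⟩ ∈ Γ :=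
      fun g f hf => by
        rw [hyd f hf]
        exact hΓ.act g (hd f hf)
    -- A surjective operator has a section, which would bring `x` itself into the domain. So the old
    -- and the new graph overlap only over proper faces.
    have hnot : ∀ {m : SimplexCategory} (g : G) (f : m ⟶ ⦋k⦌) (z : S.obj (op m)),
        ⟨m, (a g).app (op m) (X.map f.op x), z⟩ ∈ Γ → IsFace f := by
      intro m g f z hz
      by_contra hf
      obtain ⟨r, hr⟩ := exists_section_of_not_isFace f hf
      have := hΓ.map r (hΓ.act g⁻¹ hz)
      rw [a_inv, ← sset_map_comp, hr, sset_map_id] at this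
      exact hx ⟨_, this⟩
    -- The forced extension: `x ↦ y` propagated by the group and by all simplicial operators.
    let Δ : Set (Σ n : SimplexCategory, X.obj (op n) × S.obj (op n)) :=
      {p | ∃ (g : G) (f : p.1 ⟶ ⦋k⦌), p.2.1 = (a g).app (op p.1) (X.map f.op x) ∧
        p.2.2 = (b g).app (op p.1) (S.map f.op y)}
    have hmem : ∀ {n z w}, ⟨n, z, w⟩ ∈ Δ → ∃ (g : G) (f : n ⟶ ⦋k⦌),
        z = (a g).app (op n) (X.map f.op x) ∧ w = (b g).app (op n) (S.map f.op y) := fun h => h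
    have hmixed : ∀ {n z w w'}, ⟨n, z, w⟩ ∈ Γ → ⟨n, z, w'⟩ ∈ Δ → w = w' := by
      intro n z w w' hw hw'
      obtain ⟨g, f, rfl, rfl⟩ := hmem hw'
      exact hΓ.func hw (hface g f (hnot g f w hw))
    have hΔ : IsPartialMap a b R (Γ ∪ Δ) := by
      refine ⟨?_, ?_, ?_, ?_⟩
      · rintro n z w (h | h')
        · exact hΓ.rel h
        · obtain ⟨g, f, rfl, rfl⟩ := hmem h'
          by_cases hf : IsFace f
          · exact hΓ.rel (hface g f hf)
          · obtain ⟨r, hr⟩ := exists_section_of_not_isFace f hf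
            exact R_act _ _ _ _ (R_degen f r hr x y hxy)
      · rintro h n z w (hzw | h')
        · exact Or.inl (hΓ.act h hzw)
        · obtain ⟨g, f, rfl, rfl⟩ := hmem h'
          exact Or.inr ⟨h * g, f, (a_mul h g _ _).symm, (b_mul h g _ _).symm⟩
      · rintro m n f' z w (hzw | h')
        · exact Or.inl (hΓ.map f' hzw)
        · obtain ⟨g, f, rfl, rfl⟩ := hmem h'
          refine Or.inr ⟨g, f' ≫ f, ?_, ?_⟩
          · change X.map f'.op _ = (a g).app (op m) (X.map (f' ≫ f).op x)
            rw [sset_map_comp, sset_hom_map (a g) f']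
          · change S.map f'.op _ = (b g).app (op m) (S.map (f' ≫ f).op y)
            rw [sset_map_comp, sset_hom_map (b g) f']
      · rintro n z w w' (h | h) (h' | h')
        · exact hΓ.func h h'
        · exact hmixed h h'
        · exact (hmixed h' h).symm
        · obtain ⟨g, f, hz, hw⟩ := hmem h
          obtain ⟨g', f', hz', hw'⟩ := hmem h'
          by_cases hf : IsFace f
          · have := hface g f hf
            rw [← hz, ← hw] at this
            exact hmixed this h'
          by_cases hf' : IsFace f'
          · have := hface g' f' hf'
            rw [← hz', ← hw'] at this
            exact (hmixed this h).symm
          -- Two presentations by surjective operators: uniqueness in the Eilenberg–Zilber lemma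
          -- gives `f = f'` and `g x = g' x`. Then `g'⁻¹ g` stabilizes `x`, hence fixes `y` by
          -- `R_stab`.
          have hz₁ : z = X.map f.op ((a g).app (op ⦋k⦌) x) := by rw [hz, sset_hom_map]
          have hz₂ : z = X.map f'.op ((a g').app (op ⦋k⦌) x) := by rw [hz', sset_hom_map]
          have : Epi f := SimplexCategory.epi_iff_surjective.2 (not_not.1 hf)
          have hs : (a g).app (op ⦋k⦌) x = (a g').app (op ⦋k⦌) x := congr_arg Subtype.val
            (X.unique_nonDegenerate_simplex (n := n.len) z f ⟨_, hnd g⟩ hz₁ f' ⟨_, hnd g'⟩ hz₂)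
          have hff : f = f' :=
            X.unique_nonDegenerate_map (n := n.len) z f ⟨_, hnd g⟩ hz₁ f' ⟨_, hnd g'⟩ hz₂
          have hstab : (b (g'⁻¹ * g)).app (op ⦋k⦌) y = y := R_stab _ _ x y hxy (by
            rw [a_mul, hs, a_inv])
          have hy : (b g).app (op ⦋k⦌) y = (b g').app (op ⦋k⦌) y := by
            conv_rhs => rw [← hstab]
            rw [← b_mul, mul_inv_cancel_left]
          rw [hw, hw', sset_hom_map, sset_hom_map, hff, hy]
    have hle : Γ ∪ Δ ⊆ Γ := hmax hΔ Set.subset_union_left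
    refine hx ⟨y, hle (Or.inr ⟨1, 𝟙 _, ?_, ?_⟩)⟩
    · change x = (a 1).app _ (X.map (𝟙 (⦋k⦌ : SimplexCategory)).op x)
      rw [sset_map_id, a_one]
    · change y = (b 1).app _ (S.map (𝟙 (⦋k⦌ : SimplexCategory)).op y)
      rw [sset_map_id, b_one]
  have hdom' : ∀ (n : SimplexCategory) (x : X.obj (op n)), ∃ y, ⟨n, x, y⟩ ∈ Γ :=
    fun n x => hdom n.len x
  choose φ hφ using hdom'
  refine ⟨{ app := fun n => ↾fun x => φ n.unop x
            naturality := fun n m f => ?_ }, fun g n x => ?_, fun n x => hΓ.rel (hφ n x)⟩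
  · ext x
    exact hΓ.func (hφ m.unop _) (hΓ.map f.unop (hφ n.unop x))
  · exact hΓ.func (hφ n _) (hΓ.act g (hφ n x))

end EquivariantExtension

/-! ### Equivariant acyclic carriers -/

/-! ### Realizations of thin categories and of their full subcategories -/

section ThinCategories

/-- The singular simplex given by a continuous map. -/
noncomputable def singMk {Y : TopCat.{u}} {n : SimplexCategory} (k : C(TopSimplex n, Y)) :
    (TopCat.toSSet.obj Y).obj (op n) :=
  (TopCat.toSSetObjEquiv Y (op n)).symm k

theorem singMap_singMk {Y : TopCat.{u}} {n : SimplexCategory} (k : C(TopSimplex n, Y)) :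
    singMap (singMk k) = k :=
  (TopCat.toSSetObjEquiv Y (op n)).apply_symm_apply k

/-- The geometric realization of the nerve of a small category. -/
noncomputable abbrev catReal (A : Type u) [Category.{u} A] : TopCat.{u} :=
  SSet.toTop.obj (nerve A)

/-- The map of realizations induced by a functor. -/
noncomputable abbrev catRealMap {A B : Type u} [Category.{u} A] [Category.{u} B] (F : A ⥤ B) :
    catReal A ⟶ catReal B :=
  SSet.toTop.map (nerveMap F)

variable {A B D : Type u} [Category.{u} A] [Category.{u} B] [Category.{u} D]

theorem catRealMap_comp_apply (F : A ⥤ B) (F' : B ⥤ D) (p : catReal A) :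
    catRealMap (F ⋙ F') p = catRealMap F' (catRealMap F p) := by
  have h : nerveMap (F ⋙ F') = nerveMap F ≫ nerveMap F' := rfl
  simp only [catRealMap, h, Functor.map_comp]
  rfl

theorem catRealMap_id_apply (p : catReal A) : catRealMap (𝟭 A) p = p := by
  have h : nerveMap (𝟭 A) = 𝟙 (nerve A) := rfl
  simp only [catRealMap, h, CategoryTheory.Functor.map_id]
  rfl

theorem thin_functor_ext [Quiver.IsThin B] {F F' : A ⥤ B} (h : ∀ x, F.obj x = F'.obj x) :
    F = F' :=
  CategoryTheory.Functor.ext h fun _ _ _ => Subsingleton.elim (α := (_ ⟶ (_ : B))) _ _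

/-- The full subcategory on a set of objects. -/
abbrev SubCat (S : Set D) : Type u := ObjectProperty.FullSubcategory (fun d => d ∈ S)

instance [Quiver.IsThin D] (S : Set D) : Quiver.IsThin (SubCat S) := fun _ _ =>
  ⟨fun f g => ObjectProperty.hom_ext _ (Subsingleton.elim f.hom g.hom)⟩

/-- The inclusion of the full subcategory on a set of objects. -/
abbrev SubCat.incl (S : Set D) : SubCat S ⥤ D := ObjectProperty.ι _

/-- The functor between full subcategories induced by a functor. -/
def SubCat.map (F : B ⥤ D) {S : Set B} {S' : Set D} (h : ∀ b ∈ S, F.obj b ∈ S') :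
    SubCat S ⥤ SubCat S' :=
  ObjectProperty.lift _ (SubCat.incl S ⋙ F) fun b => h b.1 b.2

theorem catRealMap_incl_map (F : B ⥤ D) {S : Set B} {S' : Set D}
    (h : ∀ b ∈ S, F.obj b ∈ S') (p : catReal (SubCat S)) :
    catRealMap (SubCat.incl S') (catRealMap (SubCat.map F h) p) =
      catRealMap F (catRealMap (SubCat.incl S) p) := by
  rw [← catRealMap_comp_apply, ← catRealMap_comp_apply]
  rfl

/-- Simplices of the nerve of a thin category are determined by their vertices. Consequently
factorizations through the realization of a full subcategory are unique, and so automatically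
compatible on common faces. -/
theorem catRealMap_incl_injective [Quiver.IsThin D] (S : Set D) :
    Function.Injective (catRealMap (SubCat.incl S)) :=
  toTop_map_injective (nerveMap (SubCat.incl S)) fun n x y h => by
    apply nerve.ext_of_isThin
    funext i
    exact ObjectProperty.FullSubcategory.ext
      (congr_arg (fun z : (nerve D).obj (op n) => z.obj i) h)

theorem catRealMap_incl_of_fixed [Quiver.IsThin D] (F : D ⥤ D) {S : Set D}
    (h : ∀ d ∈ S, F.obj d = d) (p : catReal (SubCat S)) :
    catRealMap F (catRealMap (SubCat.incl S) p) = catRealMap (SubCat.incl S) p := by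
  rw [← catRealMap_comp_apply]
  have : SubCat.incl S ⋙ F = SubCat.incl S := thin_functor_ext fun d => h d.1 d.2
  rw [this]

/-- A map to the realization of `D` takes values in the realization of a full subcategory. -/
def FactorsSub {T : Type*} [TopologicalSpace T] (S : Set D) (k : T → catReal D) : Prop :=
  ∃ k' : C(T, catReal (SubCat S)), ∀ t, catRealMap (SubCat.incl S) (k' t) = k t

theorem FactorsSub.map {T : Type*} [TopologicalSpace T] {S : Set B} {k : T → catReal B}
    (hk : FactorsSub S k) (F : B ⥤ D) {S' : Set D} (h : ∀ b ∈ S, F.obj b ∈ S') :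
    FactorsSub S' (fun t => catRealMap F (k t)) := by
  obtain ⟨k', hk'⟩ := hk
  refine ⟨(catRealMap (SubCat.map F h)).hom.comp k', fun t => ?_⟩
  change _ = catRealMap F (k t)
  rw [← hk' t]
  exact catRealMap_incl_map F h (k' t)

theorem FactorsSub.mono {T : Type*} [TopologicalSpace T] {S S' : Set D} {k : T → catReal D}
    (hk : FactorsSub S k) (h : S ⊆ S') : FactorsSub S' k := by
  have := hk.map (𝟭 D) (S' := S') h
  simpa only [catRealMap_id_apply] using this

theorem FactorsSub.comp {T T' : Type*} [TopologicalSpace T] [TopologicalSpace T'] {S : Set D}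
    {k : T → catReal D} (hk : FactorsSub S k) (q : C(T', T)) : FactorsSub S (fun t => k (q t)) := by
  obtain ⟨k', hk'⟩ := hk
  exact ⟨k'.comp q, fun t => hk' (q t)⟩

theorem FactorsSub.fixed [Quiver.IsThin D] {T : Type*} [TopologicalSpace T] {S : Set D}
    {k : T → catReal D} (hk : FactorsSub S k) (F : D ⥤ D) (h : ∀ d ∈ S, F.obj d = d) (t : T) :
    catRealMap F (k t) = k t := by
  obtain ⟨k', hk'⟩ := hk
  rw [← hk' t]
  exact catRealMap_incl_of_fixed F h (k' t)

end ThinCategories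

/-! ### The equivariant acyclic carrier theorem -/

section Carriers

variable {G : Type u} {E D : Type u} [Category.{u} E] [Category.{u} D]

/-- An equivariant acyclic carrier from the simplices of the nerve of `E` to the full
subcategories of `D`. -/
structure IsCarrier (FE : G → (E ⥤ E)) (FD : G → (D ⥤ D))
    (K : ∀ n : SimplexCategory, (nerve E).obj (op n) → Set D) : Prop where
  mono : ∀ {m n : SimplexCategory} (f : m ⟶ n) (x : (nerve E).obj (op n)),
    K m ((nerve E).map f.op x) ⊆ K n x
  act : ∀ (g : G) (n : SimplexCategory) (x : (nerve E).obj (op n)), ∀ d ∈ K n x,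
    (FD g).obj d ∈ K n ((nerveMap (FE g)).app (op n) x)
  fix : ∀ (g : G) (n : SimplexCategory) (x : (nerve E).obj (op n)),
    (nerveMap (FE g)).app (op n) x = x → ∀ d ∈ K n x, (FD g).obj d = d
  contractible : ∀ (n : SimplexCategory) (x : (nerve E).obj (op n)),
    ContractibleSpace (catReal (SubCat (K n x)))

/-- A map of realizations is carried by `K`. -/
def IsCarried (K : ∀ n : SimplexCategory, (nerve E).obj (op n) → Set D)
    (φ : catReal E ⟶ catReal D) : Prop :=
  ∀ (n : SimplexCategory) (x : (nerve E).obj (op n)),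
    FactorsSub (K n x) (fun t => φ (charMap x t))

variable {FE : G → (E ⥤ E)} {FD : G → (D ⥤ D)}
  {K : ∀ n : SimplexCategory, (nerve E).obj (op n) → Set D}

/-- A simplex is a restriction of each of its degeneracies, so monotonicity applies in the reverse
direction too. -/
theorem IsCarrier.subset_of_section (hK : IsCarrier FE FD K) {m n : SimplexCategory} (f : m ⟶ n)
    (r : n ⟶ m) (hr : r ≫ f = 𝟙 n) (x : (nerve E).obj (op n)) :
    K n x ⊆ K m ((nerve E).map f.op x) := by
  have := hK.mono r ((nerve E).map f.op x)
  rwa [← sset_map_comp, hr, sset_map_id] at this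

variable [Group G] [Quiver.IsThin E] [Quiver.IsThin D]

/-- Maps carried by an equivariant acyclic carrier exist. -/
theorem IsCarrier.exists_isCarried (hK : IsCarrier FE FD K)
    (hE_one : ∀ x, (FE 1).obj x = x)
    (hE_mul : ∀ g h x, (FE (g * h)).obj x = (FE g).obj ((FE h).obj x))
    (hD_one : ∀ x, (FD 1).obj x = x)
    (hD_mul : ∀ g h x, (FD (g * h)).obj x = (FD g).obj ((FD h).obj x)) :
    ∃ φ : catReal E ⟶ catReal D,
      (∀ g p, φ (catRealMap (FE g) p) = catRealMap (FD g) (φ p)) ∧ IsCarried K φ := by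
  have hD1 : FD 1 = 𝟭 D := thin_functor_ext hD_one
  have hDm : ∀ g h, FD (g * h) = FD h ⋙ FD g := fun g h => thin_functor_ext (hD_mul g h)
  obtain ⟨φ, hφ, hR⟩ := exists_equivariant_map (a := fun g => nerveMap (FE g))
    (b := fun g => TopCat.toSSet.map (catRealMap (FD g)))
    (R := fun n x y => FactorsSub (K n x) (singMap y))
    (fun n x => nerve.ext_of_isThin (funext fun i => hE_one _))
    (fun g h n x => nerve.ext_of_isThin (funext fun i => hE_mul g h _))
    (fun n y => singMap_injective (by
      ext t
      rw [singMap_toSSet_map, hD1, catRealMap_id_apply]))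
    (fun g h n y => singMap_injective (by
      ext t
      rw [singMap_toSSet_map, singMap_toSSet_map, singMap_toSSet_map, hDm, catRealMap_comp_apply]))
    (fun g n x y h => h.map (FD g) (hK.act g n x))
    (fun g n x y h hx => singMap_injective (by
      ext t
      exact h.fixed (FD g) (hK.fix g n x hx) t))
    (fun f r hr x y h => (h.comp (topSimplexMap f)).mono (hK.subset_of_section f r hr x))
    (fun n x d hd => by
      -- The boundary values are moved into the single contractible space `|K n x|` by monotonicity,
      -- and the filling takes place there.
      have := hK.contractible n x
      choose k hk using fun (m : SimplexCategory) (f : m ⟶ n) (hf : IsFace f) =>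
        (hd f hf).mono (hK.mono f x)
      let d' : BoundaryFamily (TopCat.toSSet.obj (catReal (SubCat (K n x)))) n :=
        { val := fun {m} f hf => singMk (k m f hf)
          map_val := fun g f hf => singMap_injective (by
            ext t
            apply catRealMap_incl_injective
            rw [singMap_map, singMap_singMk, singMap_singMk, hk, hk, ← d.map_val g f hf,
              singMap_map]) }
      obtain ⟨y, hy⟩ := exists_fill_of_contractible d'
      refine ⟨(TopCat.toSSet.map (catRealMap (SubCat.incl (K n x)))).app (op n) y,
        ⟨singMap y, fun t => rfl⟩, fun {m} f hf => singMap_injective ?_⟩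
      ext t
      rw [singMap_map, singMap_toSSet_map, ← singMap_map, hy f hf, ← hk m f hf t]
      exact congr_arg _ (congr_arg (fun c : C(TopSimplex m, _) => c t) (singMap_singMk _)))
  refine ⟨realDesc φ, fun g p => ?_, fun n x => ?_⟩
  · have : catRealMap (FE g) ≫ realDesc φ = realDesc φ ≫ catRealMap (FD g) := by
      apply real_hom_ext
      intro n x t
      change realDesc φ (catRealMap (FE g) (charMap x t)) =
        catRealMap (FD g) (realDesc φ (charMap x t))
      rw [toTop_map_charMap, realDesc_charMap, realDesc_charMap, hφ, singMap_toSSet_map]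
    exact congr_arg (fun k : catReal E ⟶ catReal D => k p) this
  · have := hR n x
    simpa only [realDesc_charMap] using this

/-- The map of path spaces induced by a continuous map. -/
def pathSpaceMap {V W : TopCat.{u}} (k : V ⟶ W) : pathSpace V ⟶ pathSpace W :=
  TopCat.ofHom ⟨fun γ => k.hom.comp γ, k.hom.continuous_postcomp⟩

theorem pathSpaceMap_apply {V W : TopCat.{u}} (k : V ⟶ W) (γ : C(unitInterval, V))
    (s : unitInterval) : (pathSpaceMap k γ : C(unitInterval, W)) s = k (γ s) := rfl

/-- A family of paths lies in the realization of a full subcategory. -/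
def FactorsSubPath {n : SimplexCategory} (S : Set D) (k : TopSimplex n → pathSpace (catReal D)) :
    Prop :=
  ∃ k' : C(TopSimplex n, pathSpace (catReal (SubCat S))), ∀ t (s : unitInterval),
    catRealMap (SubCat.incl S) ((k' t : C(unitInterval, catReal (SubCat S))) s) =
      (k t : C(unitInterval, catReal D)) s

/-- Two equivariant maps carried by the same equivariant acyclic carrier are equivariantly
homotopic. -/
theorem IsCarrier.exists_homotopy (hK : IsCarrier FE FD K)
    (hE_one : ∀ x, (FE 1).obj x = x)
    (hE_mul : ∀ g h x, (FE (g * h)).obj x = (FE g).obj ((FE h).obj x))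
    (hD_one : ∀ x, (FD 1).obj x = x)
    (hD_mul : ∀ g h x, (FD (g * h)).obj x = (FD g).obj ((FD h).obj x))
    {φ₀ φ₁ : catReal E ⟶ catReal D}
    (h₀ : ∀ g p, φ₀ (catRealMap (FE g) p) = catRealMap (FD g) (φ₀ p)) (hc₀ : IsCarried K φ₀)
    (h₁ : ∀ g p, φ₁ (catRealMap (FE g) p) = catRealMap (FD g) (φ₁ p)) (hc₁ : IsCarried K φ₁) :
    ∃ F : ContinuousMap.Homotopy φ₀.hom φ₁.hom, ∀ g t p,
      F (t, catRealMap (FE g) p) = catRealMap (FD g) (F (t, p)) := by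
  have hD1 : FD 1 = 𝟭 D := thin_functor_ext hD_one
  have hDm : ∀ g h, FD (g * h) = FD h ⋙ FD g := fun g h => thin_functor_ext (hD_mul g h)
  -- A homotopy is sought as a map from `|E|` to the space of paths in `|D|`; the relation keeps
  -- each path inside its carrier and prescribes its endpoints.
  obtain ⟨φ, hφ, hR⟩ := exists_equivariant_map (a := fun g => nerveMap (FE g))
    (b := fun g => TopCat.toSSet.map (pathSpaceMap (catRealMap (FD g))))
    (R := fun n x y => FactorsSubPath (K n x) (singMap y) ∧
      ∀ t, (singMap y t : C(unitInterval, catReal D)) 0 = φ₀ (charMap x t) ∧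
        (singMap y t : C(unitInterval, catReal D)) 1 = φ₁ (charMap x t))
    (fun n x => nerve.ext_of_isThin (funext fun i => hE_one _))
    (fun g h n x => nerve.ext_of_isThin (funext fun i => hE_mul g h _))
    (fun n y => singMap_injective (by
      ext t : 1
      refine ContinuousMap.ext fun s => ?_
      rw [singMap_toSSet_map, pathSpaceMap_apply, hD1, catRealMap_id_apply]))
    (fun g h n y => singMap_injective (by
      ext t : 1
      refine ContinuousMap.ext fun s => ?_
      rw [singMap_toSSet_map, singMap_toSSet_map, singMap_toSSet_map, pathSpaceMap_apply,
        pathSpaceMap_apply, pathSpaceMap_apply, hDm, catRealMap_comp_apply]))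
    (fun g n x y h => by
      obtain ⟨⟨k, hk⟩, he⟩ := h
      refine ⟨⟨(pathSpaceMap (catRealMap (SubCat.map (FD g) (hK.act g n x)))).hom.comp k,
        fun t s => ?_⟩, fun t => ?_⟩
      · rw [singMap_toSSet_map, pathSpaceMap_apply, ← hk]
        exact catRealMap_incl_map (FD g) (hK.act g n x) _
      · rw [singMap_toSSet_map, pathSpaceMap_apply, pathSpaceMap_apply, (he t).1, (he t).2,
          ← h₀, ← h₁, toTop_map_charMap]
        exact ⟨rfl, rfl⟩)
    (fun g n x y h hx => singMap_injective (by
      obtain ⟨⟨k, hk⟩, -⟩ := h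
      ext t : 1
      refine ContinuousMap.ext fun s => ?_
      rw [singMap_toSSet_map, pathSpaceMap_apply, ← hk]
      exact catRealMap_incl_of_fixed (FD g) (hK.fix g n x hx) _))
    (fun f r hr x y h => by
      obtain ⟨⟨k, hk⟩, he⟩ := h
      refine ⟨⟨(pathSpaceMap (catRealMap (SubCat.map (𝟭 D)
        (hK.subset_of_section f r hr x)))).hom.comp (k.comp (topSimplexMap f)),
        fun t s => ?_⟩, fun t => ?_⟩
      · rw [singMap_map, ← hk]
        exact (catRealMap_incl_map (𝟭 D) (hK.subset_of_section f r hr x) _).trans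
          (catRealMap_id_apply _)
      · rw [singMap_map, charMap_map]
        exact he _)
    (fun n x d hd => by
      have := hK.contractible n x
      choose k hk using fun (m : SimplexCategory) (f : m ⟶ n) (hf : IsFace f) => (hd f hf).1
      let incl : ∀ {m : SimplexCategory} (f : m ⟶ n),
          pathSpace (catReal (SubCat (K m ((nerve E).map f.op x)))) ⟶
            pathSpace (catReal (SubCat (K n x))) := fun f =>
        pathSpaceMap (catRealMap (SubCat.map (𝟭 D) (hK.mono f x)))
      have hincl : ∀ {m : SimplexCategory} (f : m ⟶ n) (hf : IsFace f) (t) (s : unitInterval),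
          catRealMap (SubCat.incl (K n x)) ((incl f (k m f hf t) :
            C(unitInterval, catReal (SubCat (K n x)))) s) =
          (singMap (d.val f hf) t : C(unitInterval, catReal D)) s := fun {m} f hf t s => by
        rw [← hk m f hf]
        exact (catRealMap_incl_map (𝟭 D) (hK.mono f x) _).trans (catRealMap_id_apply _)
      let d' : BoundaryFamily (TopCat.toSSet.obj (pathSpace (catReal (SubCat (K n x))))) n :=
        { val := fun {m} f hf => singMk ((incl f).hom.comp (k m f hf))
          map_val := fun g f hf => singMap_injective (by
            ext t : 1
            refine ContinuousMap.ext fun s => catRealMap_incl_injective _ ?_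
            rw [singMap_map, singMap_singMk, singMap_singMk]
            refine (hincl f hf _ s).trans (Eq.trans ?_ (hincl (g ≫ f) (hf.comp g) t s).symm)
            rw [← d.map_val g f hf, singMap_map]) }
      obtain ⟨e₀, he₀⟩ := hc₀ n x
      obtain ⟨e₁, he₁⟩ := hc₁ n x
      obtain ⟨y, hy, hye⟩ := exists_fill_path_of_contractible d' e₀ e₁
        (fun f hf t => catRealMap_incl_injective _ (by
          refine Eq.trans ?_ (he₀ (topSimplexMap f t)).symm
          change _ = φ₀ (charMap x (topSimplexMap f t))
          rw [← charMap_map, ← ((hd f hf).2 t).1, ← hincl]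
          simp only [d', singMap_singMk]
          rfl))
        (fun f hf t => catRealMap_incl_injective _ (by
          refine Eq.trans ?_ (he₁ (topSimplexMap f t)).symm
          change _ = φ₁ (charMap x (topSimplexMap f t))
          rw [← charMap_map, ← ((hd f hf).2 t).2, ← hincl]
          simp only [d', singMap_singMk]
          rfl))
      refine ⟨(TopCat.toSSet.map (pathSpaceMap (catRealMap (SubCat.incl (K n x))))).app (op n) y,
        ⟨⟨singMap y, fun t s => rfl⟩, fun t => ?_⟩, fun {m} f hf => singMap_injective ?_⟩
      · rw [singMap_toSSet_map, pathSpaceMap_apply, pathSpaceMap_apply, (hye t).1, (hye t).2]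
        exact ⟨he₀ t, he₁ t⟩
      · ext t : 1
        refine ContinuousMap.ext fun s => ?_
        rw [singMap_map, singMap_toSSet_map, ← singMap_map, hy f hf, pathSpaceMap_apply,
          ← hincl f hf]
        simp only [d', singMap_singMk]
        rfl)
  let Φ : C(catReal E, C(unitInterval, catReal D)) := (realDesc φ).hom
  have hΦ : ∀ {n : SimplexCategory} (x : (nerve E).obj (op n)) (t : TopSimplex n),
      Φ (charMap x t) = singMap (φ.app (op n) x) t := fun x t => realDesc_charMap φ x t
  -- Evaluation at a fixed time is a map out of `|E|`, so the endpoints need checking only on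
  -- simplices.
  have hev : ∀ (s : unitInterval) (k : catReal E ⟶ catReal D),
      (∀ (n : SimplexCategory) (x : (nerve E).obj (op n)) (t : TopSimplex n),
        (singMap (φ.app (op n) x) t : C(unitInterval, catReal D)) s = k (charMap x t)) →
      ∀ p, Φ p s = k p := fun s k hk p => by
    have : TopCat.ofHom ⟨fun p => Φ p s, (continuous_eval_const s).comp Φ.continuous⟩ = k := by
      apply real_hom_ext
      intro n x t
      rw [← hk, ← hΦ]
      rfl
    rw [← this]
    rfl
  refine ⟨⟨⟨fun q => Φ q.2 q.1, continuous_eval.comp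
      ((Φ.continuous.comp continuous_snd).prodMk continuous_fst)⟩,
      hev 0 φ₀ fun n x t => ((hR n x).2 t).1, hev 1 φ₁ fun n x t => ((hR n x).2 t).2⟩,
      fun g s p => ?_⟩
  have : catRealMap (FE g) ≫ realDesc φ = realDesc φ ≫ pathSpaceMap (catRealMap (FD g)) := by
    apply real_hom_ext
    intro n x t
    change realDesc φ (catRealMap (FE g) (charMap x t)) =
      pathSpaceMap (catRealMap (FD g)) (realDesc φ (charMap x t))
    rw [toTop_map_charMap, realDesc_charMap, realDesc_charMap, hφ, singMap_toSSet_map]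
  exact congr_arg (fun k : catReal E ⟶ pathSpace (catReal D) =>
    (k p : C(unitInterval, catReal D)) s) this

end Carriers

/-! ### Contractibility of realizations of thin categories -/

section Contractibility

variable {A B D : Type u} [Category.{u} A] [Category.{u} B] [Category.{u} D]

/-- A map on objects, monotone for the existence of morphisms, as a functor between thin
categories. -/
noncomputable def thinFunctor {A B : Type*} [Category* A] [Category* B] [Quiver.IsThin B]
    (f : A → B) (h : ∀ x y, (x ⟶ y) → Nonempty (f x ⟶ f y)) : A ⥤ B where
  obj := f
  map k := (h _ _ k).some
  map_id _ := Subsingleton.elim _ _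
  map_comp _ _ := Subsingleton.elim _ _

/-- The cone on a simplex of the nerve, with vertex an initial object. -/
noncomputable def coneSimplex [Quiver.IsThin D] (z : D) (hz : ∀ d, Nonempty (z ⟶ d))
    {n : SimplexCategory} (x : (nerve D).obj (op n)) : (nerve D).obj (op ⦋n.len + 1⦌) :=
  thinFunctor (A := Fin (n.len + 1 + 1)) (Fin.cons z x.obj : Fin (n.len + 1 + 1) → D)
    fun i j hij => by
      induction i using Fin.cases with
      | zero => exact hz _
      | succ i =>
        induction j using Fin.cases with
        | zero => exact absurd (leOfHom hij) (Fin.succ_pos i).not_ge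
        | succ j => exact ⟨x.map (homOfLE (Fin.succ_le_succ_iff.1 (leOfHom hij)))⟩

/-- The cone on a simplicial operator. -/
def coneOperator {m n : SimplexCategory} (f : m ⟶ n) :
    (⦋m.len + 1⦌ : SimplexCategory) ⟶ ⦋n.len + 1⦌ :=
  SimplexCategory.Hom.mk ⟨(Fin.cons 0 fun i => (f.toOrderHom i).succ :
    Fin (m.len + 1 + 1) → Fin (n.len + 1 + 1)), fun i j hij => by
      induction i using Fin.cases with
      | zero => exact Fin.zero_le _
      | succ i =>
        induction j using Fin.cases with
        | zero => exact absurd hij (Fin.succ_pos i).not_ge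
        | succ j =>
          exact Fin.succ_le_succ_iff.2 (f.toOrderHom.monotone (Fin.succ_le_succ_iff.1 hij))⟩

/-- The inclusion of the base of a cone. -/
def coneBase (n : SimplexCategory) : n ⟶ ⦋n.len + 1⦌ :=
  SimplexCategory.Hom.mk ⟨Fin.succ, (Fin.strictMono_succ).monotone⟩

/-- The constant operator at the vertex of a cone. -/
def coneVertex (n : SimplexCategory) : n ⟶ ⦋n.len + 1⦌ :=
  SimplexCategory.Hom.mk ⟨fun _ => 0, monotone_const⟩

/-- The operator to the point. -/
def toPoint (n : SimplexCategory) : n ⟶ ⦋0⦌ :=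
  SimplexCategory.Hom.mk ⟨fun _ => 0, monotone_const⟩

/-- The vertex of the nerve given by an object. -/
def nervePoint (z : D) : (nerve D).obj (op ⦋0⦌) := ComposableArrows.mk₀ z

theorem nerve_map_coneOperator [Quiver.IsThin D] (z : D) (hz : ∀ d, Nonempty (z ⟶ d))
    {m n : SimplexCategory} (f : m ⟶ n) (x : (nerve D).obj (op n)) :
    (nerve D).map (coneOperator f).op (coneSimplex z hz x) =
      coneSimplex z hz ((nerve D).map f.op x) := by
  apply nerve.ext_of_isThin
  funext i
  change Fin (m.len + 1 + 1) at i
  induction i using Fin.cases with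
  | zero => rfl
  | succ i => rfl

theorem nerve_map_coneBase [Quiver.IsThin D] (z : D) (hz : ∀ d, Nonempty (z ⟶ d))
    {n : SimplexCategory} (x : (nerve D).obj (op n)) :
    (nerve D).map (coneBase n).op (coneSimplex z hz x) = x :=
  nerve.ext_of_isThin (funext fun _ => rfl)

theorem nerve_map_coneVertex [Quiver.IsThin D] (z : D) (hz : ∀ d, Nonempty (z ⟶ d))
    {n : SimplexCategory} (x : (nerve D).obj (op n)) :
    (nerve D).map (coneVertex n).op (coneSimplex z hz x) =
      (nerve D).map (toPoint n).op (nervePoint z) :=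
  nerve.ext_of_isThin (funext fun _ => rfl)

theorem topSimplexMap_apply' {m n : SimplexCategory} (f : m ⟶ n) (t : TopSimplex m)
    (i : Fin (n.len + 1)) :
    topSimplexMap f t i = ∑ j, if f.toOrderHom j = i then t j else 0 := by
  rw [topSimplexMap_apply, Finset.sum_filter]
  rfl

/-- The join coordinates on the cone over a topological simplex. -/
noncomputable def joinPoint (n : SimplexCategory) :
    C(TopSimplex n × unitInterval, TopSimplex ⦋n.len + 1⦌) where
  toFun p := ⟨(Fin.cons (1 - (p.2 : ℝ)) fun i => (p.2 : ℝ) * p.1 i :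
    Fin (n.len + 1 + 1) → ℝ), by
      constructor
      · intro i
        induction i using Fin.cases with
        | zero => simpa using p.2.2.2
        | succ i => simpa using mul_nonneg p.2.2.1 (stdSimplex.zero_le p.1 i)
      · refine (Fin.sum_univ_succ _).trans ?_
        simp only [Fin.cons_zero, Fin.cons_succ, ← Finset.mul_sum]
        rw [show ∑ i, p.1 i = 1 from stdSimplex.sum_eq_one p.1]
        ring⟩
  continuous_toFun := by
    refine Continuous.subtype_mk (continuous_pi fun i => ?_) _
    change Fin (n.len + 1 + 1) at i
    induction i using Fin.cases with
    | zero => exact continuous_const.sub (continuous_subtype_val.comp continuous_snd)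
    | succ i =>
      exact (continuous_subtype_val.comp continuous_snd).mul
        ((continuous_apply i).comp (continuous_subtype_val.comp continuous_fst))

theorem joinPoint_zero (n : SimplexCategory) (p : TopSimplex n × unitInterval) :
    joinPoint n p (0 : Fin (n.len + 1 + 1)) = 1 - (p.2 : ℝ) := rfl

theorem joinPoint_succ (n : SimplexCategory) (p : TopSimplex n × unitInterval)
    (i : Fin (n.len + 1)) : joinPoint n p i.succ = (p.2 : ℝ) * p.1 i := rfl

/-- This naturality makes the straight-line paths to the cone vertex agree across faces and
degeneracies. -/
theorem topSimplexMap_coneOperator {m n : SimplexCategory} (f : m ⟶ n) (t : TopSimplex m)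
    (s : unitInterval) :
    topSimplexMap (coneOperator f) (joinPoint m (t, s)) = joinPoint n (topSimplexMap f t, s) := by
  ext i
  change Fin (n.len + 1 + 1) at i
  have h0 : (coneOperator f).toOrderHom (0 : Fin (m.len + 1 + 1)) = (0 : Fin (n.len + 1 + 1)) := rfl
  have hs : ∀ j : Fin (m.len + 1),
      (coneOperator f).toOrderHom j.succ = (f.toOrderHom j).succ := fun j => rfl
  rw [topSimplexMap_apply']
  refine (Fin.sum_univ_succ _).trans ?_
  induction i using Fin.cases with
  | zero =>
    rw [if_pos h0, joinPoint_zero, joinPoint_zero, Finset.sum_eq_zero, add_zero]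
    intro j _
    rw [if_neg]
    rw [hs]
    exact Fin.succ_ne_zero _
  | succ i =>
    rw [if_neg (by rw [h0]; exact (Fin.succ_ne_zero i).symm), zero_add, joinPoint_succ,
      topSimplexMap_apply', Finset.mul_sum]
    refine Finset.sum_congr rfl fun j _ => ?_
    rw [hs, joinPoint_succ, mul_ite, mul_zero]
    simp only [Fin.succ_inj]

theorem joinPoint_one_eq {n : SimplexCategory} (t : TopSimplex n) :
    joinPoint n (t, 1) = topSimplexMap (coneBase n) t := by
  ext i
  change Fin (n.len + 1 + 1) at i
  induction i using Fin.cases with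
  | zero =>
    rw [joinPoint_zero, topSimplexMap_apply', Finset.sum_eq_zero]
    · exact sub_self _
    · intro j _
      exact if_neg (Fin.succ_ne_zero j)
  | succ i =>
    rw [joinPoint_succ]
    refine Eq.trans ?_ (topSimplexMap_apply_of_injective (coneBase n)
      (Fin.succ_injective _) t i).symm
    exact one_mul _

theorem joinPoint_zero_eq {n : SimplexCategory} (t : TopSimplex n) :
    joinPoint n (t, 0) = topSimplexMap (coneVertex n) t := by
  ext i
  change Fin (n.len + 1 + 1) at i
  induction i using Fin.cases with
  | zero =>
    rw [joinPoint_zero, topSimplexMap_apply']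
    refine (sub_zero (1 : ℝ)).trans ((stdSimplex.sum_eq_one t).symm.trans ?_)
    exact Finset.sum_congr rfl fun j _ => (if_pos rfl).symm
  | succ i =>
    rw [joinPoint_succ, topSimplexMap_apply', Finset.sum_eq_zero]
    · exact zero_mul _
    · intro j _
      exact if_neg (Fin.succ_ne_zero i).symm

/-- A thin category with an object that maps to every object has contractible realization. -/
theorem contractibleSpace_catReal_of_initial [Quiver.IsThin D] (z : D)
    (hz : ∀ d, Nonempty (z ⟶ d)) : ContractibleSpace (catReal D) := by
  -- Each point of a simplex `x` is joined to `z` by a segment in the cone on `x`: time `0` is the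
  -- vertex `z`, time `1` the original point.
  let φ : nerve D ⟶ TopCat.toSSet.obj (pathSpace (catReal D)) :=
    toSSetMk (fun n x => ((charMap (coneSimplex z hz x)).comp (joinPoint n)).curry)
      (fun {m n} f x t => by
        refine ContinuousMap.ext fun s => ?_
        change charMap (coneSimplex z hz ((nerve D).map f.op x)) (joinPoint m (t, s)) =
          charMap (coneSimplex z hz x) (joinPoint n (topSimplexMap f t, s))
        rw [← nerve_map_coneOperator, charMap_map, topSimplexMap_coneOperator])
  let Φ : C(catReal D, C(unitInterval, catReal D)) := (realDesc φ).hom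
  have hΦ : ∀ {n : SimplexCategory} (x : (nerve D).obj (op n)) (t : TopSimplex n)
      (s : unitInterval), Φ (charMap x t) s = charMap (coneSimplex z hz x) (joinPoint n (t, s)) :=
    fun {n} x t s => by
      have : Φ (charMap x t) = ((charMap (coneSimplex z hz x)).comp (joinPoint n)).curry t := by
        refine (realDesc_charMap φ x t).trans ?_
        exact congr_arg (fun k : C(TopSimplex n, pathSpace (catReal D)) => k t)
          (singMap_toSSetMk _ _ x)
      rw [this]
      rfl
  let t₀ : TopSimplex ⦋0⦌ := default
  let p₀ : catReal D := charMap (nervePoint z) t₀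
  have hev : ∀ (s : unitInterval) (k : C(catReal D, catReal D)),
      (∀ (n : SimplexCategory) (x : (nerve D).obj (op n)) (t : TopSimplex n),
        charMap (coneSimplex z hz x) (joinPoint n (t, s)) = k (charMap x t)) →
      ∀ p, Φ p s = k p := fun s k hk p => by
    have : TopCat.ofHom ⟨fun p => Φ p s, (continuous_eval_const s).comp Φ.continuous⟩ =
        TopCat.ofHom k := by
      apply real_hom_ext
      intro n x t
      exact (hΦ x t s).trans (hk n x t)
    exact congr_arg (fun l : catReal D ⟶ catReal D => l p) this
  have h0 : ∀ p, Φ p 0 = p₀ := hev 0 (ContinuousMap.const _ p₀) fun n x t => by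
    rw [joinPoint_zero_eq, ← charMap_map, nerve_map_coneVertex, charMap_map]
    exact congr_arg _ (Subsingleton.elim (α := stdSimplex ℝ (Fin 1)) _ _)
  have h1 : ∀ p, Φ p 1 = p := hev 1 (ContinuousMap.id _) fun n x t => by
    rw [joinPoint_one_eq, ← charMap_map, nerve_map_coneBase]
    rfl
  let H : ContinuousMap.Homotopy (ContinuousMap.const (catReal D) p₀) (ContinuousMap.id _) :=
    ⟨⟨fun q => Φ q.2 q.1, continuous_eval.comp
      ((Φ.continuous.comp continuous_snd).prodMk continuous_fst)⟩, h0, h1⟩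
  exact (contractible_iff_id_nullhomotopic _).2 ⟨p₀, ⟨H.symm⟩⟩

/-- A simplex lies in a full subcategory as soon as its vertices do. This is the test by which the
realization of a functor is seen to be carried. -/
theorem factorsSub_charMap (F : A ⥤ D) {n : SimplexCategory} (x : (nerve A).obj (op n))
    {S : Set D} (h : ∀ i, F.obj (x.obj i) ∈ S) :
    FactorsSub S (fun t => catRealMap F (charMap x t)) := by
  let x' : (nerve (SubCat S)).obj (op n) := ObjectProperty.lift _ (x ⋙ F) h
  refine ⟨charMap x', fun t => ?_⟩
  change _ = catRealMap F (charMap x t)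
  rw [toTop_map_charMap, toTop_map_charMap]
  rfl

/-- Functors between thin categories related by a natural transformation have homotopic
realizations. -/
theorem homotopic_catRealMap [Quiver.IsThin A] [Quiver.IsThin D] (F F' : A ⥤ D)
    (h : ∀ x, Nonempty (F.obj x ⟶ F'.obj x)) :
    (catRealMap F).hom.Homotopic (catRealMap F').hom := by
  -- The objects under `F x₀` have `F x₀` as initial object and contain all `F xᵢ` and `F' xᵢ`; the
  -- carrier theorem is applied with the trivial group.
  let K : ∀ n : SimplexCategory, (nerve A).obj (op n) → Set D := fun n x =>
    {d | Nonempty (F.obj (x.obj 0) ⟶ d)}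
  have hF : ∀ (n : SimplexCategory) (x : (nerve A).obj (op n)) i, F.obj (x.obj i) ∈ K n x :=
    fun n x i => ⟨F.map (x.map (homOfLE (Fin.zero_le i)))⟩
  have hK : IsCarrier (G := PUnit.{u + 1}) (fun _ => 𝟭 A) (fun _ => 𝟭 D) K :=
    { mono := fun f x d hd => ⟨F.map (x.map (homOfLE (Fin.zero_le _))) ≫ hd.some⟩
      act := fun g n x d hd => hd
      fix := fun g n x _ d _ => rfl
      contractible := fun n x => contractibleSpace_catReal_of_initial
        (⟨F.obj (x.obj 0), hF n x 0⟩ : SubCat (K n x)) fun d =>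
          ⟨ObjectProperty.homMk d.2.some⟩ }
  obtain ⟨H, -⟩ := hK.exists_homotopy (fun _ => rfl) (fun _ _ _ => rfl) (fun _ => rfl)
    (fun _ _ _ => rfl) (φ₀ := catRealMap F) (φ₁ := catRealMap F')
    (fun g p => by rw [catRealMap_id_apply, catRealMap_id_apply])
    (fun n x => factorsSub_charMap F x (hF n x))
    (fun g p => by rw [catRealMap_id_apply, catRealMap_id_apply])
    (fun n x => factorsSub_charMap F' x fun i => ⟨(hF n x i).some ≫ (h _).some⟩)
  exact ⟨H⟩

/-- If the identity of a thin category maps to a functor factoring through a category with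
contractible realization, then its realization is contractible. -/
theorem contractibleSpace_catReal_of_retract [Quiver.IsThin A] [ContractibleSpace (catReal B)]
    (F : A ⥤ B) (F' : B ⥤ A) (h : ∀ x, Nonempty (x ⟶ F'.obj (F.obj x))) :
    ContractibleSpace (catReal A) := by
  rw [contractible_iff_id_nullhomotopic]
  obtain ⟨p, hp⟩ := (contractible_iff_id_nullhomotopic (catReal B)).1 inferInstance
  have h1 : (catRealMap (𝟭 A)).hom = ContinuousMap.id (catReal A) :=
    ContinuousMap.ext catRealMap_id_apply
  have h2 : (catRealMap (F ⋙ F')).hom =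
      (catRealMap F').hom.comp ((ContinuousMap.id _).comp (catRealMap F).hom) :=
    ContinuousMap.ext fun q => catRealMap_comp_apply F F' q
  refine ⟨catRealMap F' p, ?_⟩
  rw [← h1]
  refine (homotopic_catRealMap (𝟭 A) (F ⋙ F') h).trans ?_
  rw [h2]
  exact (ContinuousMap.Homotopic.refl _).comp (hp.comp (ContinuousMap.Homotopic.refl _))

/-- A thin category with an object comparable to every object has contractible realization. -/
theorem contractibleSpace_catReal_of_comparable [Quiver.IsThin D] (z : D)
    (hz : ∀ d, Nonempty (d ⟶ z) ∨ Nonempty (z ⟶ d)) : ContractibleSpace (catReal D) := by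
  classical
  let U : Set D := {d | Nonempty (z ⟶ d)}
  have : ContractibleSpace (catReal (SubCat U)) :=
    contractibleSpace_catReal_of_initial (⟨z, ⟨𝟙 z⟩⟩ : SubCat U) fun d =>
      ⟨ObjectProperty.homMk d.2.some⟩
  -- Pushing `d` up to `z` when it is not already above `z` retracts onto the objects under `z`,
  -- where `z` is initial.
  let f : D → SubCat U := fun d => if h : Nonempty (z ⟶ d) then ⟨d, h⟩ else ⟨z, ⟨𝟙 z⟩⟩
  have hf : ∀ d, Nonempty (d ⟶ (f d).obj) := fun d => by
    by_cases h : Nonempty (z ⟶ d)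
    · simp only [f, dif_pos h]
      exact ⟨𝟙 d⟩
    · simp only [f, dif_neg h]
      exact (hz d).resolve_right h
  have hmono : ∀ d d', (d ⟶ d') → Nonempty (f d ⟶ f d') := fun d d' k => by
    by_cases h : Nonempty (z ⟶ d)
    · have h' : Nonempty (z ⟶ d') := ⟨h.some ≫ k⟩
      simp only [f, dif_pos h, dif_pos h']
      exact ⟨ObjectProperty.homMk k⟩
    · simp only [f, dif_neg h]
      exact ⟨ObjectProperty.homMk (f d').2.some⟩
  exact contractibleSpace_catReal_of_retract (thinFunctor f hmono) (SubCat.incl U) hf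

end Contractibility

/-! ### Removing objects from a thin `G`-category -/

section LinkCarrier

variable {G : Type u} {E' E : Type u} [Category.{u} E'] [Category.{u} E]

/-- The objects of `E'` that are fixed by `H` and whose image in `E` is comparable to `p`. -/
def linkSet (FE' : G → (E' ⥤ E')) (J : E' ⥤ E) (H : Set G) (p : E) : Set E' :=
  {z | (∀ g ∈ H, (FE' g).obj z = z) ∧ (Nonempty (J.obj z ⟶ p) ∨ Nonempty (p ⟶ J.obj z))}

/-- The pointwise stabilizer of the vertices of a simplex of the nerve. -/
def chainStabilizer (FE : G → (E ⥤ E)) {n : SimplexCategory} (x : (nerve E).obj (op n)) : Set G :=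
  {g | ∀ j, (FE g).obj (x.obj j) = x.obj j}

/-- The carrier sending a simplex with a bad vertex to the fixed points of the link of this
vertex, and any other simplex to the objects isomorphic to one of its vertices. -/
def linkCarrier (FE : G → (E ⥤ E)) (FE' : G → (E' ⥤ E')) (J : E' ⥤ E) (bad : E → Prop)
    (n : SimplexCategory) (x : (nerve E).obj (op n)) : Set E' :=
  {z | ((∀ i, ¬ bad (x.obj i)) ∧
      ∃ i, Nonempty (J.obj z ⟶ x.obj i) ∧ Nonempty (x.obj i ⟶ J.obj z)) ∨
    ∃ i, bad (x.obj i) ∧ z ∈ linkSet FE' J (chainStabilizer FE x) (x.obj i)}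

/-- The assumptions under which `linkCarrier` is an equivariant acyclic carrier. -/
structure LinkCarrierAssumptions (FE : G → (E ⥤ E)) (FE' : G → (E' ⥤ E')) (J : E' ⥤ E)
    (bad : E → Prop) : Prop where
  comm : ∀ g z, J.obj ((FE' g).obj z) = (FE g).obj (J.obj z)
  reflects : ∀ z z', (J.obj z ⟶ J.obj z') → Nonempty (z ⟶ z')
  bad_act : ∀ g x, bad ((FE g).obj x) ↔ bad x
  bad_antichain : ∀ x y, bad x → bad y → (x ⟶ y) → Nonempty (y ⟶ x)
  exists_preimage : ∀ x, ¬ bad x → ∃ z, Nonempty (J.obj z ⟶ x) ∧ Nonempty (x ⟶ J.obj z)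
  fix : ∀ g z x, (J.obj z ⟶ x) → (x ⟶ J.obj z) → (FE g).obj x = x → (FE' g).obj z = z
  contractible : ∀ (n : SimplexCategory) (x : (nerve E).obj (op n)) (i : Fin (n.len + 1)),
    bad (x.obj i) →
      ContractibleSpace (catReal (SubCat (linkSet FE' J (chainStabilizer FE x) (x.obj i))))

variable {FE : G → (E ⥤ E)} {FE' : G → (E' ⥤ E')} {J : E' ⥤ E} {bad : E → Prop}

theorem nerve_obj_comparable {n : SimplexCategory} (x : (nerve E).obj (op n))
    (i j : Fin (n.len + 1)) :
    Nonempty (x.obj i ⟶ x.obj j) ∨ Nonempty (x.obj j ⟶ x.obj i) :=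
  (le_total i j).imp (fun h => ⟨x.map (homOfLE h)⟩) (fun h => ⟨x.map (homOfLE h)⟩)

theorem linkSet_subset_of_iso {H : Set G} {p q : E} (f : p ⟶ q) (f' : q ⟶ p) :
    linkSet FE' J H p ⊆ linkSet FE' J H q := fun _ hz =>
  ⟨hz.1, hz.2.imp (fun h => ⟨h.some ≫ f⟩) (fun h => ⟨f' ≫ h.some⟩)⟩

/-- Bad vertices of one chain are comparable, hence isomorphic by `bad_antichain`, so they share the
same link and the choice of bad vertex is irrelevant. -/
theorem LinkCarrierAssumptions.linkCarrier_eq (h : LinkCarrierAssumptions FE FE' J bad)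
    {n : SimplexCategory} (x : (nerve E).obj (op n)) (i : Fin (n.len + 1))
    (hi : bad (x.obj i)) :
    linkCarrier FE FE' J bad n x = linkSet FE' J (chainStabilizer FE x) (x.obj i) := by
  ext z
  constructor
  · rintro (⟨hx, -⟩ | ⟨j, hj, hz⟩)
    · exact absurd hi (hx i)
    · rcases nerve_obj_comparable x i j with ⟨⟨f⟩⟩ | ⟨⟨f⟩⟩
      · exact linkSet_subset_of_iso (h.bad_antichain _ _ hi hj f).some f hz
      · exact linkSet_subset_of_iso f (h.bad_antichain _ _ hj hi f).some hz
  · exact fun hz => Or.inr ⟨i, hi, hz⟩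

/-- Enlarging a chain shrinks its stabilizer, so the fixed part of the link of a bad vertex grows.
If a chain acquires its first bad vertex, objects isomorphic to an old vertex are comparable to the
bad one, and `fix` makes the stabilizer fix them. -/
theorem LinkCarrierAssumptions.isCarrier [Group G] [Quiver.IsThin E']
    (h : LinkCarrierAssumptions FE FE' J bad)
    (hE_one : ∀ x, (FE 1).obj x = x)
    (hE_mul : ∀ g h x, (FE (g * h)).obj x = (FE g).obj ((FE h).obj x))
    (hE'_mul : ∀ g h x, (FE' (g * h)).obj x = (FE' g).obj ((FE' h).obj x)) :
    IsCarrier FE FE' (linkCarrier FE FE' J bad) where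
  mono {m n} f x z hz := by
    have hf : ∀ i, ((nerve E).map f.op x).obj i = x.obj (f.toOrderHom i) := fun i => rfl
    rcases hz with ⟨hb, i, hi, hi'⟩ | ⟨i, hi, hz, hz'⟩
    · by_cases hx : ∀ j, ¬ bad (x.obj j)
      · exact Or.inl ⟨hx, f.toOrderHom i, hi, hi'⟩
      · push Not at hx
        obtain ⟨j, hj⟩ := hx
        refine Or.inr ⟨j, hj, fun g hg => ?_, ?_⟩
        · exact h.fix g z (x.obj (f.toOrderHom i)) hi.some hi'.some (hg _)
        · exact (nerve_obj_comparable x (f.toOrderHom i) j).imp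
            (fun k => ⟨hi.some ≫ k.some⟩) (fun k => ⟨k.some ≫ hi'.some⟩)
    · exact Or.inr ⟨f.toOrderHom i, hi, fun g hg => hz g fun j => hg (f.toOrderHom j), hz'⟩
  act g n x z hz := by
    have hgx : ∀ i, ((nerveMap (FE g)).app (op n) x).obj i = (FE g).obj (x.obj i) := fun i => rfl
    rcases hz with ⟨hb, i, hi, hi'⟩ | ⟨i, hi, hz, hz'⟩
    · refine Or.inl ⟨fun j hj => hb j ((h.bad_act g _).1 hj), i, ?_, ?_⟩
      · rw [h.comm]
        exact ⟨(FE g).map hi.some⟩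
      · rw [h.comm]
        exact ⟨(FE g).map hi'.some⟩
    · refine Or.inr ⟨i, (h.bad_act g _).2 hi, fun k hk => ?_, ?_⟩
      · have hk' : (FE' (g⁻¹ * (k * g))).obj z = z := by
          refine hz _ fun j => ?_
          have := hk j
          rw [hgx, ← hE_mul] at this
          rw [hE_mul, this, ← hE_mul, inv_mul_cancel, hE_one]
        rw [← hE'_mul, ← mul_inv_cancel_left g (k * g), hE'_mul, hk']
      · rw [h.comm]
        exact hz'.imp (fun k => ⟨(FE g).map k.some⟩) (fun k => ⟨(FE g).map k.some⟩)
  fix g n x hx z hz := by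
    have hgx : ∀ i, (FE g).obj (x.obj i) = x.obj i := fun i =>
      congr_arg (fun y : (nerve E).obj (op n) => y.obj i) hx
    rcases hz with ⟨hb, i, hi, hi'⟩ | ⟨i, hi, hz, hz'⟩
    · exact h.fix g z (x.obj i) hi.some hi'.some (hgx i)
    · exact hz g hgx
  contractible n x := by
    by_cases hx : ∃ j, bad (x.obj j)
    · obtain ⟨j, hj⟩ := hx
      rw [h.linkCarrier_eq x j hj]
      exact h.contractible n x j hj
    · push Not at hx
      -- Without bad vertices, a preimage of the first vertex up to isomorphism maps to every object
      -- of the carrier.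
      obtain ⟨z, hz, hz'⟩ := h.exists_preimage (x.obj 0) (hx 0)
      refine contractibleSpace_catReal_of_initial
        (⟨z, Or.inl ⟨hx, 0, hz, hz'⟩⟩ : SubCat (linkCarrier FE FE' J bad n x)) ?_
      rintro ⟨w, ⟨-, i, hw, hw'⟩ | ⟨i, hi, -⟩⟩
      · exact ⟨ObjectProperty.homMk (h.reflects z w
          (hz.some ≫ x.map (homOfLE (Fin.zero_le i)) ≫ hw'.some)).some⟩
      · exact absurd hi (hx i)

theorem IsCarrier.precomp {D : Type u} [Category.{u} D] [Quiver.IsThin E] {FD : G → (D ⥤ D)}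
    {K : ∀ n : SimplexCategory, (nerve E).obj (op n) → Set D} (hK : IsCarrier FE FD K)
    (hJ : ∀ g z, J.obj ((FE' g).obj z) = (FE g).obj (J.obj z)) :
    IsCarrier FE' FD (fun n x => K n ((nerveMap J).app (op n) x)) := by
  have hcomm : ∀ g (n : SimplexCategory) (x : (nerve E').obj (op n)),
      (nerveMap J).app (op n) ((nerveMap (FE' g)).app (op n) x) =
        (nerveMap (FE g)).app (op n) ((nerveMap J).app (op n) x) := fun g n x =>
    nerve.ext_of_isThin (funext fun i => hJ g _)
  refine ⟨fun f x => hK.mono f ((nerveMap J).app _ x), fun g n x d hd => ?_, fun g n x hx => hK.fix g n _ ?_,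
    fun n x => hK.contractible n _⟩
  · rw [hcomm]
    exact hK.act g n _ d hd
  · rw [← hcomm, hx]

/-- When the target is `E` itself, the bad vertex belongs to its own link set and is comparable to
everything in it, so contractibility needs no hypothesis on links. -/
theorem LinkCarrierAssumptions.id (h : LinkCarrierAssumptions FE FE' J bad)
    [Quiver.IsThin E]
    (hfix : ∀ g y x, (y ⟶ x) → (x ⟶ y) → (FE g).obj x = x → (FE g).obj y = y) :
    LinkCarrierAssumptions FE FE (𝟭 E) bad where
  comm _ _ := rfl
  reflects _ _ f := ⟨f⟩
  bad_act := h.bad_act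
  bad_antichain := h.bad_antichain
  exists_preimage x _ := ⟨x, ⟨𝟙 x⟩, ⟨𝟙 x⟩⟩
  fix := hfix
  contractible _ x i _ := contractibleSpace_catReal_of_comparable
    (⟨x.obj i, fun _ hg => hg i, Or.inl ⟨𝟙 _⟩⟩ :
      SubCat (linkSet FE (𝟭 E) (chainStabilizer FE x) (x.obj i))) fun d =>
    d.2.2.imp (fun k => ⟨ObjectProperty.homMk k.some⟩) (fun k => ⟨ObjectProperty.homMk k.some⟩)

/-- A `G`-functor between thin `G`-categories whose image misses some objects only, all of them
with links whose fixed points are contractible, is a `G`-homotopy equivalence. -/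
theorem LinkCarrierAssumptions.isGHomotopyEquiv [Group G] [Quiver.IsThin E] [Quiver.IsThin E']
    (h : LinkCarrierAssumptions FE FE' J bad)
    (hfix : ∀ g y x, (y ⟶ x) → (x ⟶ y) → (FE g).obj x = x → (FE g).obj y = y)
    (hgood : ∀ z, ¬ bad (J.obj z))
    (hE_one : ∀ x, (FE 1).obj x = x)
    (hE_mul : ∀ g h x, (FE (g * h)).obj x = (FE g).obj ((FE h).obj x))
    (hE'_one : ∀ x, (FE' 1).obj x = x)
    (hE'_mul : ∀ g h x, (FE' (g * h)).obj x = (FE' g).obj ((FE' h).obj x)) :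
    IsGHomotopyEquiv ((gRealization G).map
      (thinActionHom (h_one := hE'_one) (h_mul := hE'_mul) (h_one' := hE_one)
        (h_mul' := hE_mul) J h.comm)) := by
  have hK := h.isCarrier hE_one hE_mul hE'_mul
  have hK₁ := (h.id hfix).isCarrier hE_one hE_mul hE_mul
  have hJ : ∀ g p, catRealMap J (catRealMap (FE' g) p) = catRealMap (FE g) (catRealMap J p) :=
    fun g p => by
      rw [← catRealMap_comp_apply, ← catRealMap_comp_apply]
      congr 2
      exact congr_arg _ (thin_functor_ext (h.comm g))
  obtain ⟨r, hr, hrc⟩ := hK.exists_isCarried hE_one hE_mul hE'_one hE'_mul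
  obtain ⟨F, hF⟩ := (hK.precomp h.comm).exists_homotopy hE'_one hE'_mul hE'_one hE'_mul
    (φ₀ := catRealMap J ≫ r) (φ₁ := 𝟙 _)
    (fun g p => by
      change r (catRealMap J (catRealMap (FE' g) p)) = catRealMap (FE' g) (r (catRealMap J p))
      rw [hJ, hr])
    (fun n x => by
      have := hrc n ((nerveMap J).app (op n) x)
      simp only [← toTop_map_charMap] at this
      exact this)
    (fun g p => rfl)
    (fun n x => by
      have := factorsSub_charMap (𝟭 E') x
        (S := linkCarrier FE FE' J bad n ((nerveMap J).app (op n) x))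
        -- No vertex in the image of `J` is bad, so the identity is carried by the first clause.
        fun i => Or.inl ⟨fun j => hgood _, i, ⟨𝟙 _⟩, ⟨𝟙 _⟩⟩
      simp only [catRealMap_id_apply] at this
      exact this)
  obtain ⟨F', hF'⟩ := hK₁.exists_homotopy hE_one hE_mul hE_one hE_mul
    (φ₀ := r ≫ catRealMap J) (φ₁ := 𝟙 _)
    (fun g p => by
      change catRealMap J (r (catRealMap (FE g) p)) = catRealMap (FE g) (catRealMap J (r p))
      rw [hr, hJ])
    (fun n x => (hrc n x).map J fun z hz => by
      rcases hz with hz | ⟨i, hi, hz, hz'⟩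
      · exact Or.inl hz
      · exact Or.inr ⟨i, hi, fun g hg => (h.comm g z).symm.trans (congr_arg J.obj (hz g hg)),
          hz'⟩)
    (fun g p => rfl)
    (fun n x => by
      have := factorsSub_charMap (𝟭 E) x (S := linkCarrier FE FE (𝟭 E) bad n x) fun i => by
        by_cases hx : ∃ j, bad (x.obj j)
        · obtain ⟨j, hj⟩ := hx
          exact Or.inr ⟨j, hj, fun g hg => hg i, nerve_obj_comparable x i j⟩
        · push Not at hx
          exact Or.inl ⟨hx, i, ⟨𝟙 _⟩, ⟨𝟙 _⟩⟩
      simp only [catRealMap_id_apply] at this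
      exact this)
  refine ⟨⟨r, fun g => ?_⟩, ⟨F, fun g t p => hF g t p⟩, ⟨F', fun g t p => hF' g t p⟩⟩
  ext p
  exact hr g p

end LinkCarrier

/-! ### Categories modelled on a collection of subgroups -/

section Conjugation

variable {G : Type u} [Group G]

theorem mem_conjSubgroup_iff {g x : G} {H : Subgroup G} :
    x ∈ conjSubgroup g H ↔ g⁻¹ * x * g ∈ H := by
  constructor
  · rintro ⟨y, hy, rfl⟩
    simpa [mul_assoc] using hy
  · exact fun h => ⟨g⁻¹ * x * g, h, by simp [mul_assoc]⟩

theorem conjSubgroup_inv_conjSubgroup (g : G) (H : Subgroup G) :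
    conjSubgroup g⁻¹ (conjSubgroup g H) = H := by
  rw [← conjSubgroup_mul, inv_mul_cancel, conjSubgroup_one]

theorem conjSubgroup_conjSubgroup_inv (g : G) (H : Subgroup G) :
    conjSubgroup g (conjSubgroup g⁻¹ H) = H := by
  rw [← conjSubgroup_mul, mul_inv_cancel, conjSubgroup_one]

theorem conjSubgroup_le_iff {g : G} {H K : Subgroup G} :
    conjSubgroup g H ≤ K ↔ H ≤ conjSubgroup g⁻¹ K := by
  constructor
  · intro h
    have := conjSubgroup_mono g⁻¹ h
    rwa [conjSubgroup_inv_conjSubgroup] at this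
  · intro h
    have := conjSubgroup_mono g h
    rwa [conjSubgroup_conjSubgroup_inv] at this

theorem le_conjSubgroup_iff {g : G} {H K : Subgroup G} :
    K ≤ conjSubgroup g H ↔ conjSubgroup g⁻¹ K ≤ H := by
  rw [conjSubgroup_le_iff, inv_inv]

theorem conjSubgroup_eq_iff {g : G} {H K : Subgroup G} :
    conjSubgroup g H = K ↔ H = conjSubgroup g⁻¹ K := by
  constructor
  · rintro rfl
    rw [conjSubgroup_inv_conjSubgroup]
  · rintro rfl
    rw [conjSubgroup_conjSubgroup_inv]

theorem mem_normalizer_iff_conjSubgroup_eq {g : G} {H : Subgroup G} :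
    g ∈ Subgroup.normalizer (H : Set G) ↔ conjSubgroup g H = H := by
  rw [← inv_mem_iff, Subgroup.mem_normalizer_iff, SetLike.ext_iff]
  refine forall_congr' fun x => ?_
  rw [mem_conjSubgroup_iff, inv_inv]
  exact iff_comm

theorem normalizer_conjSubgroup (g : G) (H : Subgroup G) :
    Subgroup.normalizer (conjSubgroup g H : Set G) =
      conjSubgroup g (Subgroup.normalizer (H : Set G)) := by
  ext x
  rw [mem_conjSubgroup_iff, mem_normalizer_iff_conjSubgroup_eq, mem_normalizer_iff_conjSubgroup_eq,
    conjSubgroup_mul, conjSubgroup_mul, conjSubgroup_eq_iff (g := g⁻¹), inv_inv]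

theorem centralizer_conjSubgroup (g : G) (H : Subgroup G) :
    Subgroup.centralizer (conjSubgroup g H : Set G) =
      conjSubgroup g (Subgroup.centralizer (H : Set G)) := by
  ext x
  rw [mem_conjSubgroup_iff, Subgroup.mem_centralizer_iff, Subgroup.mem_centralizer_iff]
  constructor
  · intro h y hy
    have := h (g * y * g⁻¹) (mem_conjSubgroup_iff.2 (by simpa [mul_assoc] using hy))
    have := congr_arg (fun z => g⁻¹ * z * g) this
    simpa [mul_assoc] using this
  · intro h y hy
    have := h _ (mem_conjSubgroup_iff.1 hy)
    have := congr_arg (fun z => g * z * g⁻¹) this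
    simpa [mul_assoc] using this

/-- Conjugating the larger subgroup back to `P` reduces to the hypothesis. Thus the conjugates of
`P` form an antichain. -/
theorem conjSubgroup_eq_of_le {P : Subgroup G}
    (hP : ∀ g : G, conjSubgroup g P ≤ P → conjSubgroup g P = P) {g k : G}
    (h : conjSubgroup g P ≤ conjSubgroup k P) : conjSubgroup g P = conjSubgroup k P := by
  rw [le_conjSubgroup_iff, ← conjSubgroup_mul] at h
  have := hP _ h
  rwa [conjSubgroup_mul, conjSubgroup_eq_iff, inv_inv] at this

/-- A subgroup strictly comparable to `P` cannot be conjugate to `P`, so the link already lies in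
the smaller collection. -/
theorem SubgroupCollection.mem_link_iff (C : SubgroupCollection G) {P : Subgroup G}
    (hP : ∀ g : G, conjSubgroup g P ≤ P → conjSubgroup g P = P) {Q : Subgroup G} :
    Q ∈ C.link P ↔ Q ∈ (C.remove P).carrier ∧ (Q ≤ P ∨ P ≤ Q) := by
  constructor
  · rintro ⟨hQ, h⟩
    refine ⟨⟨hQ, ?_⟩, h.symm.imp le_of_lt le_of_lt⟩
    rintro g rfl
    rcases h with h | h
    · have h' : conjSubgroup 1 P ≤ conjSubgroup g P := by
        rw [conjSubgroup_one]
        exact h.le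
      have := conjSubgroup_eq_of_le hP h'
      rw [conjSubgroup_one] at this
      exact h.ne this
    · exact h.ne (hP g h.le)
  · rintro ⟨⟨hQ, hg⟩, h⟩
    have hne : Q ≠ P := fun h => hg 1 (by rw [h, conjSubgroup_one])
    exact ⟨hQ, h.symm.imp (fun h => lt_of_le_of_ne h hne.symm) (fun h => lt_of_le_of_ne h hne)⟩

end Conjugation

/-! ### The common form of the three statements -/

section Models

variable {G : Type u} [Group G]

/-- A `G`-category equivalent to the poset underlying a collection of subgroups, such that an
object lying over `Q` has isotropy group `S Q`. -/
structure IsCollectionModel (C : SubgroupCollection G) (S : Subgroup G → Subgroup G)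
    {E : Type u} [Category.{u} E] (FE : G → (E ⥤ E)) (π : E → Subgroup G) : Prop where
  mem : ∀ x, π x ∈ C.carrier
  exists_eq : ∀ Q ∈ C.carrier, ∃ x, π x = Q
  le : ∀ {x y}, (x ⟶ y) → π x ≤ π y
  hom : ∀ {x y}, π x ≤ π y → Nonempty (x ⟶ y)
  act : ∀ g x, π ((FE g).obj x) = conjSubgroup g (π x)
  fix_iff : ∀ g x, (FE g).obj x = x ↔ g ∈ S (π x)

/-- Conjugation by `g⁻¹` and a section of `π` give functors between `Z` and `T`; the round trip on
`Z` preserves labels, so the identity maps to it. The element `g` transports the hypothesis at `P`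
to its conjugate. -/
theorem contractibleSpace_catReal_of_posetContractible {E : Type u} [Category.{u} E]
    [Quiver.IsThin E] {T : Set (Subgroup G)} (hT : PosetContractible T) (π : E → Subgroup G)
    (hle : ∀ {x y}, (x ⟶ y) → π x ≤ π y) (hhom : ∀ {x y}, π x ≤ π y → Nonempty (x ⟶ y))
    (g : G) {Z : Set E} (hZ : ∀ z ∈ Z, conjSubgroup g⁻¹ (π z) ∈ T)
    (hex : ∀ Q ∈ T, ∃ z ∈ Z, π z = conjSubgroup g Q) :
    ContractibleSpace (catReal (SubCat Z)) := by
  have : ContractibleSpace (catReal T) := hT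
  choose s hs hπs using hex
  let F : SubCat Z ⥤ T := thinFunctor (fun z => ⟨conjSubgroup g⁻¹ (π z.1), hZ z.1 z.2⟩)
    fun z w k => ⟨homOfLE (conjSubgroup_mono g⁻¹ (hle k.hom))⟩
  let F' : T ⥤ SubCat Z := thinFunctor (fun Q => ⟨s Q.1 Q.2, hs Q.1 Q.2⟩) fun Q R k =>
    ⟨ObjectProperty.homMk (hhom (by
      rw [hπs, hπs]
      exact conjSubgroup_mono g (leOfHom k))).some⟩
  refine contractibleSpace_catReal_of_retract F F' fun z => ⟨ObjectProperty.homMk (hhom ?_).some⟩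
  exact ((hπs _ (hZ z.1 z.2)).trans (conjSubgroup_conjSubgroup_inv g _)).ge

/-- Removing a conjugacy class of subgroups with contractible fixed points of links does not
change the `G`-homotopy type of a `G`-category modelled on a collection. -/
theorem IsCollectionModel.isGHomotopyEquiv {C : SubgroupCollection G} {P : Subgroup G}
    (hP : ∀ g : G, conjSubgroup g P ≤ P → conjSubgroup g P = P)
    {S : Subgroup G → Subgroup G} (hS : ∀ g Q, S (conjSubgroup g Q) = conjSubgroup g (S Q))
    {E' E : Type u} [Category.{u} E'] [Category.{u} E] [Quiver.IsThin E'] [Quiver.IsThin E]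
    {FE' : G → (E' ⥤ E')} {FE : G → (E ⥤ E)} {π' : E' → Subgroup G} {π : E → Subgroup G}
    (h' : IsCollectionModel (C.remove P) S FE' π') (h : IsCollectionModel C S FE π)
    {J : E' ⥤ E} (hJ : ∀ g z, J.obj ((FE' g).obj z) = (FE g).obj (J.obj z))
    (hπ : ∀ z, π (J.obj z) = π' z)
    (hE_one : ∀ x, (FE 1).obj x = x)
    (hE_mul : ∀ g h x, (FE (g * h)).obj x = (FE g).obj ((FE h).obj x))
    (hE'_one : ∀ x, (FE' 1).obj x = x)
    (hE'_mul : ∀ g h x, (FE' (g * h)).obj x = (FE' g).obj ((FE' h).obj x))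
    (hlink : ∀ H, H ≤ S P →
      PosetContractible ({Q | Q ∈ C.link P ∧ H ≤ S Q} : Set (Subgroup G))) :
    IsGHomotopyEquiv ((gRealization G).map
      (thinActionHom (h_one := hE'_one) (h_mul := hE'_mul) (h_one' := hE_one)
        (h_mul' := hE_mul) J hJ)) := by
  have hbad : LinkCarrierAssumptions FE FE' J (fun x => ∃ g, π x = conjSubgroup g P) :=
    { comm := hJ
      reflects := fun z z' f => h'.hom (by
        rw [← hπ, ← hπ]
        exact h.le f)
      bad_act := fun g x => by
        rw [h.act]
        constructor
        · rintro ⟨k, hk⟩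
          exact ⟨g⁻¹ * k, by rw [conjSubgroup_mul, ← hk, conjSubgroup_inv_conjSubgroup]⟩
        · rintro ⟨k, hk⟩
          exact ⟨g * k, by rw [conjSubgroup_mul, ← hk]⟩
      bad_antichain := by
        rintro x y ⟨g, hg⟩ ⟨k, hk⟩ f
        have hle := h.le f
        rw [hg, hk] at hle
        have heq := conjSubgroup_eq_of_le hP hle
        exact h.hom (by rw [hg, hk, heq])
      exists_preimage := fun x hx => by
        obtain ⟨z, hz⟩ := h'.exists_eq (π x) ⟨h.mem x, fun g hg => hx ⟨g, hg⟩⟩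
        exact ⟨z, h.hom (by rw [hπ, hz]), h.hom (by rw [hπ, hz])⟩
      fix := fun g z x f f' hx => by
        rw [h'.fix_iff, ← hπ, le_antisymm (h.le f) (h.le f'), ← h.fix_iff]
        exact hx
      contractible := by
        rintro n x i ⟨g, hg⟩
        -- `H` is the stabilizer of the chain. Since one vertex is labelled by the conjugate of `P`
        -- by `g`, the conjugate of `H` by `g⁻¹` lies in `S P`, and the hypothesis applies to it.
        let H : Subgroup G := ⨅ j, S (π (x.obj j))
        have hH : ∀ k, k ∈ H ↔ k ∈ chainStabilizer FE x := fun k => by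
          rw [Subgroup.mem_iInf]
          exact forall_congr' fun j => (h.fix_iff k _).symm
        have hHP : conjSubgroup g⁻¹ H ≤ S P := by
          rw [← le_conjSubgroup_iff, ← hS, ← hg]
          exact iInf_le _ i
        refine contractibleSpace_catReal_of_posetContractible (hlink _ hHP) π' h'.le h'.hom g
          ?_ ?_
        · rintro z ⟨hz, hz'⟩
          refine ⟨(C.mem_link_iff hP).2 ⟨(C.remove P).conj_mem _ _ (h'.mem z), ?_⟩, ?_⟩
          · rw [← le_conjSubgroup_iff, ← conjSubgroup_le_iff, ← hg, ← hπ]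
            exact hz'.imp (fun f => h.le f.some) (fun f => h.le f.some)
          · rw [hS]
            exact conjSubgroup_mono _ fun k hk => (h'.fix_iff k z).1 (hz k ((hH k).1 hk))
        · rintro Q ⟨hQ, hHQ⟩
          rw [C.mem_link_iff hP] at hQ
          obtain ⟨z, hz⟩ := h'.exists_eq _ ((C.remove P).conj_mem g Q hQ.1)
          refine ⟨z, ⟨fun k hk => ?_, ?_⟩, hz⟩
          · rw [h'.fix_iff, hz, hS]
            exact le_conjSubgroup_iff.2 hHQ ((hH k).2 hk)
          · refine hQ.2.imp (fun hle => h.hom ?_) (fun hle => h.hom ?_)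
            all_goals
              rw [hπ, hz, hg]
              exact conjSubgroup_mono g hle }
  refine hbad.isGHomotopyEquiv (fun g y x f f' hx => ?_) (fun z hz => ?_) hE_one hE_mul hE'_one
    hE'_mul
  · rw [h.fix_iff, le_antisymm (h.le f) (h.le f'), ← h.fix_iff]
    exact hx
  · obtain ⟨g, hg⟩ := hz
    exact (h'.mem z).2 g ((hπ z).symm.trans hg)

end Models

/-! ### The three models: the poset, `EO` and `EA` -/

namespace SubgroupCollection

variable {G : Type u} [Group G] (C : SubgroupCollection G)

theorem isCollectionModel_poset : IsCollectionModel C (fun Q => Subgroup.normalizer (Q : Set G))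
    C.conjFunctor (fun Q => Q.1) where
  mem Q := Q.2
  exists_eq Q hQ := ⟨⟨Q, hQ⟩, rfl⟩
  le f := leOfHom f
  hom h := ⟨homOfLE h⟩
  act _ _ := rfl
  fix_iff _ _ := by
    rw [mem_normalizer_iff_conjSubgroup_eq, Subtype.ext_iff]
    rfl

theorem stabilizer_mk_eq_conjSubgroup (H : Subgroup G) (g : G) :
    MulAction.stabilizer G (g : G ⧸ H) = conjSubgroup g H := by
  ext x
  rw [MulAction.mem_stabilizer_iff, mem_conjSubgroup_iff, eq_comm]
  refine (QuotientGroup.eq (s := H) (a := g) (b := x * g)).trans ?_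
  rw [mul_assoc]

/-- By transitivity every point of `G/H` is `s • X.pt`, which is sent to `s • Y.pt`; the inclusion
of stabilizers makes this independent of `s`. -/
theorem EO.nonempty_hom {X Y : EO C}
    (h : MulAction.stabilizer G X.pt ≤ MulAction.stabilizer G Y.pt) : Nonempty (X ⟶ Y) := by
  choose s hs using MulAction.exists_smul_eq G X.pt
  have key : ∀ g k : G, g • X.pt = k • X.pt → g • Y.pt = k • Y.pt := fun g k hgk => by
    have : k⁻¹ * g ∈ MulAction.stabilizer G Y.pt := h (by
      rw [MulAction.mem_stabilizer_iff, mul_smul, hgk, inv_smul_smul])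
    rwa [MulAction.mem_stabilizer_iff, mul_smul, inv_smul_eq_iff] at this
  refine ⟨⟨⟨fun y => s y • Y.pt, fun g y => ?_⟩, ?_⟩⟩
  · rw [id, ← mul_smul]
    exact key _ _ (by rw [hs, mul_smul, hs])
  · exact (key _ 1 (by rw [hs, one_smul])).trans (one_smul _ _)

theorem isCollectionModel_EO : IsCollectionModel C (fun Q => Q) (EO.smulFunctor C)
    (fun X => MulAction.stabilizer G X.pt) where
  mem X := by
    obtain ⟨H, hH, x⟩ := X
    obtain ⟨g, rfl⟩ := QuotientGroup.mk_surjective x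
    rw [stabilizer_mk_eq_conjSubgroup]
    exact C.conj_mem g H hH
  exists_eq Q hQ := ⟨⟨Q, hQ, ((1 : G) : G ⧸ Q)⟩, by
    rw [stabilizer_mk_eq_conjSubgroup, conjSubgroup_one]⟩
  le {X Y} f g hg := by
    rw [MulAction.mem_stabilizer_iff] at hg ⊢
    rw [← f.map_pt, ← map_smul, hg]
  hom h := EO.nonempty_hom C h
  act g X := by
    obtain ⟨H, hH, x⟩ := X
    obtain ⟨k, rfl⟩ := QuotientGroup.mk_surjective x
    rw [stabilizer_mk_eq_conjSubgroup, ← conjSubgroup_mul]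
    exact stabilizer_mk_eq_conjSubgroup H (g * k)
  fix_iff g X := by
    obtain ⟨H, hH, x⟩ := X
    rw [MulAction.mem_stabilizer_iff]
    simp [EO.smulFunctor]

/-- The domain of `i` depends on the object, so an equality of objects is read off elementwise. -/
theorem EA.i_apply_eq_of_eq {X Y : EA C} (h : X = Y) {x : G} (hx : x ∈ X.H) (hx' : x ∈ Y.H) :
    X.i ⟨x, hx⟩ = Y.i ⟨x, hx'⟩ := by
  subst h
  rfl

theorem EA.nonempty_hom {X Y : EA C} (h : X.i.range ≤ Y.i.range) : Nonempty (X ⟶ Y) := by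
  refine ⟨⟨(MonoidHom.ofInjective Y.inj).symm.toMonoidHom.comp
    ((Subgroup.inclusion h).comp X.i.rangeRestrict), MonoidHom.ext fun x => ?_⟩⟩
  change Y.i ((MonoidHom.ofInjective Y.inj).symm ⟨X.i x, _⟩) = X.i x
  rw [MonoidHom.apply_ofInjective_symm]

/-- The isotropy is the centralizer because `c_g ∘ i = i` says exactly that `g` commutes with the
image of `i`. -/
theorem isCollectionModel_EA : IsCollectionModel C (fun Q => Subgroup.centralizer (Q : Set G))
    (EA.smulFunctor C) (fun X => X.i.range) where
  mem X := X.range_mem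
  exists_eq Q hQ := ⟨⟨Q, hQ, Q.subtype, Q.subtype_injective, by
    rwa [Subgroup.range_subtype]⟩, Q.range_subtype⟩
  le {X Y} f := by
    rintro _ ⟨x, rfl⟩
    exact ⟨f.φ x, DFunLike.congr_fun f.comp_eq x⟩
  hom h := EA.nonempty_hom C h
  act g X := MonoidHom.range_comp _ _
  fix_iff g X := by
    have hg : ∀ x, g * X.i x * g⁻¹ = X.i x ↔ X.i x * g = g * X.i x := fun x => by
      rw [mul_inv_eq_iff_eq_mul, eq_comm]
    rw [Subgroup.mem_centralizer_iff]
    constructor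
    · rintro h _ ⟨x, rfl⟩
      exact (hg x).1 (EA.i_apply_eq_of_eq C h x.2 x.2)
    · intro h
      exact EA.eq_of_i_eq rfl fun x => (hg x).2 (h _ ⟨x, rfl⟩)

end SubgroupCollection

theorem mainTheorem5 {G : Type u} [Group G] (C : SubgroupCollection G) (P : Subgroup G)
    (hP : ∀ g : G, conjSubgroup g P ≤ P → conjSubgroup g P = P) :
    ((∀ H : Subgroup G, H ≤ P → PosetContractible (C.linkGE P H)) →
      IsGHomotopyEquiv
        ((gRealization G).map (SubgroupCollection.EOIncl (C.remove_subset P)))) ∧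
    ((∀ H : Subgroup G, H ≤ Subgroup.centralizer (P : Set G) →
        PosetContractible (C.linkLE P (Subgroup.centralizer (H : Set G)))) →
      IsGHomotopyEquiv
        ((gRealization G).map (SubgroupCollection.EAIncl (C.remove_subset P)))) ∧
    ((∀ H : Subgroup G, H ≤ Subgroup.normalizer (P : Set G) →
        PosetContractible (C.linkFixed P H)) →
      IsGHomotopyEquiv
        ((gRealization G).map (SubgroupCollection.posetIncl (C.remove_subset P)))) := by
  refine ⟨fun h => ?_, fun h => ?_, fun h => ?_⟩
  · exact IsCollectionModel.isGHomotopyEquiv hP (S := fun Q => Q) (fun _ _ => rfl)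
      (C.remove P).isCollectionModel_EO C.isCollectionModel_EO
      (J :=
        { obj := fun X => (⟨X.H, C.remove_subset P X.mem, X.pt⟩ : C.EO)
          map := fun f => ⟨f.toMap, f.map_pt⟩ })
      (fun _ _ => rfl) (fun _ => rfl) _ _ _ _ h
  -- Centralizing is symmetric: `Q ≤ C_G(H)` if and only if `H ≤ C_G(Q)`.
  · have hset : ∀ H : Subgroup G, C.linkLE P (Subgroup.centralizer (H : Set G)) =
        {Q | Q ∈ C.link P ∧ H ≤ Subgroup.centralizer (Q : Set G)} := fun H =>
      Set.ext fun Q => and_congr_right fun _ => Subgroup.le_centralizer_iff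
    exact IsCollectionModel.isGHomotopyEquiv hP
      (S := fun Q => Subgroup.centralizer (Q : Set G)) centralizer_conjSubgroup
      (C.remove P).isCollectionModel_EA C.isCollectionModel_EA
      (J :=
        { obj := fun X => (⟨X.H, C.remove_subset P X.mem, X.i, X.inj,
            C.remove_subset P X.range_mem⟩ : C.EA)
          map := fun f => ⟨f.φ, f.comp_eq⟩ })
      (fun _ _ => rfl) (fun _ => rfl) _ _ _ _ fun H hH => by
        rw [← hset]
        exact h H hH
  · have hset : ∀ H, C.linkFixed P H =
        {Q | Q ∈ C.link P ∧ H ≤ Subgroup.normalizer (Q : Set G)} := fun H =>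
      Set.ext fun Q => and_congr_right fun _ =>
        forall₂_congr fun _ _ => mem_normalizer_iff_conjSubgroup_eq.symm
    exact IsCollectionModel.isGHomotopyEquiv hP
      (S := fun Q => Subgroup.normalizer (Q : Set G)) normalizer_conjSubgroup
      (C.remove P).isCollectionModel_poset C.isCollectionModel_poset
      (J := Monotone.functor (f := Set.inclusion (C.remove_subset P)) (fun _ _ h => h))
      (fun _ _ => rfl) (fun _ => rfl) _ _ _ _ fun H hH => by
        rw [← hset]
        exact h H hH
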